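/- Let $\mathfrak X$ be a spectral space, $\mathfrak X^p$ the same set with the patch (constructible) topology, $\phi:\mathfrak X^p\to\mathfrak X$ the identity map, and $T=\phi_*\phi^*$ the induced monad on the category of sheaves of sets on $\mathfrak X$. Let $\mathrm{KO}(\mathfrak X)$ be the lattice of compact open subsets of $\mathfrak X$. A skew lattice is a set $S$ with two associative idempotent operations $\curlywedge,\curlyvee$ such that $(y\curlywedge x)\curlyvee x=x=x\curlywedge(x\curlyvee y)$ and $x\curlyvee(x\curlywedge y)=x=(y\curlyvee x)\curlywedge x$. Its lattice reflection is $S/\mathcal D$, where $x\,\mathcal D\,y$ means $x\curlywedge y\curlywedge x=x$ and $y\curlywedge x\curlywedge y=y$. A right distributive skew lattice is a skew lattice which is normal ($z\curlywedge x\curlywedge y\curlywedge z=z\curlywedge y\curlywedge x\curlywedge z$), right-handed ($x\curlywedge y\curlywedge x=y\curlywedge x$) and symmetric ($x\curlywedge y=y\curlywedge x$ iff $x\curlyvee y=y\curlyvee x$), which has a zero element $0$ ($0\curlywedge x=0=x\curlywedge 0$ for all $x$), and for which $S/\mathcal D$ is a bounded distributive lattice. A right distributive skew lattice over a lattice $L$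 is one equipped with an isomorphism $S/\mathcal D\cong L$; morphisms preserve $\curlywedge$ and $\curlyvee$ and induce the identity of $L$. A sheaf on $\mathfrak X$ is global if it has a global section; a global $T$-algebra is a $T$-algebra whose underlying sheaf is global. For a sheaf $\mathcal F$ on $\mathfrak X$, let $\mathrm{el}(\mathcal F)$ be the set of pairs $(s,U)$ with $U\in\mathrm{KO}(\mathfrak X)$ and $s\in\mathcal F(U)$, with the band operation $(s,U)\curlywedge(t,V)=(t|_{U\cap V},U\cap V)$. For a morphism $\xi:T\mathcal F\to\mathcal F$ put $$(s,U)\curlyvee_\xi(t,V)=\bigl(\xi(\sigma),\,U\cup V\bigr),$$ where $\sigma\in(T\mathcal F)(U\cup V)=(\phi^*\mathcal F)(U\cup V)$ is the section that restricts to the image of $s$ on $U$ and to the image of $t$ on $V\setminus U$. **Theorem.** (1) The category of global $T$-algebras is equivalent to the category of right distributive skew lattices over $\mathrm{KO}(\mathfrak X)$. There is such an equivalence which sends $(\mathcal F,\xi)$ to a skew lattice naturally isomorphic, over $\mathrm{KO}(\mathfrak X)$, to $(\mathrm{el}(\mathcal F),\curlywedge,\curlyvee_\xi)$. (2) For every global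 sheaf $\mathcal F$ on $\mathfrak X$, the map $\xi\mapsto\curlyvee_\xi$ is a bijection from the set of $T$-algebra structures on $\mathcal F$ to the set of operations $\curlyvee$ on $\mathrm{el}(\mathcal F)$ for which $(\mathrm{el}(\mathcal F),\curlywedge,\curlyvee)$ is a right distributive skew lattice. -/

import Mathlib

open CategoryTheory TopologicalSpace Opposite

universe u

/-! ## Skew lattices -/

/-- A skew lattice: two band operations related by the four absorption laws. -/
class SkewLattice (S : Type u) where
  meet : S → S → S
  join : S → S → S
  meet_assoc : ∀ x y z : S, meet (meet x y) z = meet x (meet y z)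
  join_assoc : ∀ x y z : S, join (join x y) z = join x (join y z)
  meet_idem : ∀ x : S, meet x x = x
  join_idem : ∀ x : S, join x x = x
  meet_join_right : ∀ x y : S, join (meet y x) x = x
  meet_join_left : ∀ x y : S, meet x (join x y) = x
  join_meet_left : ∀ x y : S, join x (meet x y) = x
  join_meet_right : ∀ x y : S, meet (join y x) x = x

infixl:70 " ⋏ " => SkewLattice.meet
infixl:65 " ⋎ " => SkewLattice.join

namespace SkewLattice

section Band

variable {B : Type u} [Semigroup B]

theorem band_le_of_factor (idem : ∀ x : B, x * x = x) {x y s t : B} (h : x = s * y * t) :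
    x * y * x = x := by
  have e1 : x * y * t = x := by
    calc x * y * t = s * ((y * t) * (y * t)) := by rw [h]; simp only [mul_assoc]
      _ = s * y * t := by rw [idem, mul_assoc]
      _ = x := h.symm
  calc x * y * x = x * y * (x * y * t) := by rw [e1]
    _ = (x * y) * (x * y) * t := by simp only [mul_assoc]
    _ = x := by rw [idem, e1]

theorem band_trans (idem : ∀ x : B, x * x = x) {x y z : B} (h : x * y * x = x)
    (h' : y * z * y = y) : x * z * x = x := by
  apply band_le_of_factor idem (s := x * y) (t := y * x)
  calc x = x * (y * z * y) * x := by rw [h', h]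
    _ = x * y * z * (y * x) := by simp only [mul_assoc]

theorem band_mul_right (idem : ∀ x : B, x * x = x) {x y : B} (z : B) (h : x * y * x = x) :
    (x * z) * (y * z) * (x * z) = x * z := by
  have h1 : (x * z) * y * (x * z) = x * z := by
    apply band_le_of_factor idem (s := x) (t := x * z)
    calc x * z = (x * y * x) * z := by rw [h]
      _ = x * y * (x * z) := by simp only [mul_assoc]
  apply band_le_of_factor idem (s := x * z) (t := y * (x * z))
  calc x * z = x * (z * y) * (x * z) := by rw [← mul_assoc x z y, h1]
    _ = x * ((z * y) * (z * y)) * (x * z) := by rw [idem]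
    _ = (x * z) * (y * z) * (y * (x * z)) := by simp only [mul_assoc]

theorem band_mul_left (idem : ∀ x : B, x * x = x) {x y : B} (z : B) (h : x * y * x = x) :
    (z * x) * (z * y) * (z * x) = z * x := by
  have h1 : (z * x) * y * (z * x) = z * x := by
    apply band_le_of_factor idem (s := z * x) (t := x)
    calc z * x = z * (x * y * x) := by rw [h]
      _ = z * x * y * x := by simp only [mul_assoc]
  apply band_le_of_factor idem (s := z * x * y) (t := z * x)
  calc z * x = (z * x) * (y * z) * x := by
        conv_lhs => rw [← h1]
        simp only [mul_assoc]
    _ = (z * x) * ((y * z) * (y * z)) * x := by rw [idem]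
    _ = (z * x * y) * (z * y) * (z * x) := by simp only [mul_assoc]

theorem band_mul_comm (idem : ∀ x : B, x * x = x) (x y : B) :
    (x * y) * (y * x) * (x * y) = x * y := by
  apply band_le_of_factor idem (s := x) (t := y)
  rw [← mul_assoc, mul_assoc, idem]

end Band

variable {S : Type u} [SkewLattice S]

/-- The preorder `x ≼ y` on the band `(S, ⋏)`, defined by `x = x ⋏ y ⋏ x`. -/
def Preceq (x y : S) : Prop := x ⋏ y ⋏ x = x

/-- Green's relation `𝒟` of the band `(S, ⋏)`. -/
def GreenD (x y : S) : Prop := Preceq x y ∧ Preceq y x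

theorem preceq_iff_join (x y : S) : Preceq x y ↔ y ⋎ x ⋎ y = y := by
  constructor
  · intro h
    have h1 : x ⋎ (y ⋏ x) = y ⋏ x := by
      have := meet_join_right (y ⋏ x) x
      rwa [← meet_assoc, h] at this
    have h2 : y ⋎ (y ⋏ x) = y := join_meet_left y x
    have h3 : y ⋎ x ⋎ (y ⋏ x) = y := by rw [join_assoc, h1, h2]
    calc y ⋎ x ⋎ y = y ⋎ x ⋎ (y ⋎ x ⋎ (y ⋏ x)) := by rw [h3]
      _ = (y ⋎ x) ⋎ (y ⋎ x) ⋎ (y ⋏ x) := by simp only [join_assoc]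
      _ = y := by rw [join_idem, h3]
  · intro h
    have h1 : x ⋏ (x ⋎ y) = x := meet_join_left x y
    have h2 : (x ⋎ y) ⋏ y = y := join_meet_right y x
    have h4 : y ⋏ (x ⋎ y) = x ⋎ y := by
      have := join_meet_right (x ⋎ y) y
      rwa [← join_assoc, h] at this
    have h5 : x ⋏ y ⋏ (x ⋎ y) = x := by rw [meet_assoc, h4, h1]
    calc x ⋏ y ⋏ x = x ⋏ y ⋏ (x ⋏ y ⋏ (x ⋎ y)) := by rw [h5]
      _ = (x ⋏ y) ⋏ (x ⋏ y) ⋏ (x ⋎ y) := by simp only [meet_assoc]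
      _ = x := by rw [meet_idem, h5]

abbrev meetSemigroup (S : Type u) [SkewLattice S] : Semigroup S where
  mul := meet
  mul_assoc := meet_assoc

abbrev joinSemigroup (S : Type u) [SkewLattice S] : Semigroup S where
  mul := join
  mul_assoc := join_assoc

theorem Preceq.trans {x y z : S} (h : Preceq x y) (h' : Preceq y z) : Preceq x z :=
  @band_trans S (meetSemigroup S) meet_idem x y z h h'

theorem Preceq.meet {x x' y y' : S} (h : Preceq x x') (h' : Preceq y y') :
    Preceq (x ⋏ y) (x' ⋏ y') :=
  Preceq.trans (@band_mul_right S (meetSemigroup S) meet_idem x x' y h)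
    (@band_mul_left S (meetSemigroup S) meet_idem y y' x' h')

theorem Preceq.join {x x' y y' : S} (h : Preceq x x') (h' : Preceq y y') :
    Preceq (x ⋎ y) (x' ⋎ y') := by
  rw [preceq_iff_join] at h h' ⊢
  exact @band_trans S (joinSemigroup S) join_idem _ (x' ⋎ y) _
    (@band_mul_left S (joinSemigroup S) join_idem y' y x' h')
    (@band_mul_right S (joinSemigroup S) join_idem x' x y h)

variable (S) in
/-- Green's relation `𝒟` as an equivalence relation. -/
def greenSetoid : Setoid S where
  r := GreenD
  iseqv :=
    { refl := fun x => by
        have h : Preceq x x := by unfold Preceq; rw [meet_idem, meet_idem]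
        exact ⟨h, h⟩
      symm := fun h => ⟨h.2, h.1⟩
      trans := fun h h' => ⟨h.1.trans h'.1, h'.2.trans h.2⟩ }

variable (S) in
/-- The lattice reflection `S/𝒟` of a skew lattice. -/
def LatticeReflection : Type u := Quotient (greenSetoid S)

/-- The `𝒟`-class of an element. -/
def toReflection (x : S) : LatticeReflection S := Quotient.mk (greenSetoid S) x

/-- The lattice structure on `S/𝒟` induced by the two band operations. -/
instance : Lattice (LatticeReflection S) :=
  letI : Max (LatticeReflection S) :=
    ⟨Quotient.map₂ SkewLattice.join fun _ _ h _ _ h' => ⟨h.1.join h'.1, h.2.join h'.2⟩⟩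
  letI : Min (LatticeReflection S) :=
    ⟨Quotient.map₂ SkewLattice.meet fun _ _ h _ _ h' => ⟨h.1.meet h'.1, h.2.meet h'.2⟩⟩
  Lattice.mk'
    (by
      rintro ⟨x⟩ ⟨y⟩
      refine Quotient.sound ⟨?_, ?_⟩
      · exact (preceq_iff_join _ _).2 (@band_mul_comm S (joinSemigroup S) join_idem y x)
      · exact (preceq_iff_join _ _).2 (@band_mul_comm S (joinSemigroup S) join_idem x y))
    (by rintro ⟨x⟩ ⟨y⟩ ⟨z⟩; exact congrArg toReflection (join_assoc x y z))
    (by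
      rintro ⟨x⟩ ⟨y⟩
      exact Quotient.sound ⟨@band_mul_comm S (meetSemigroup S) meet_idem x y,
        @band_mul_comm S (meetSemigroup S) meet_idem y x⟩)
    (by rintro ⟨x⟩ ⟨y⟩ ⟨z⟩; exact congrArg toReflection (meet_assoc x y z))
    (by rintro ⟨x⟩ ⟨y⟩; exact congrArg toReflection (join_meet_left x y))
    (by rintro ⟨x⟩ ⟨y⟩; exact congrArg toReflection (meet_join_left x y))

theorem toReflection_meet (x y : S) :
    toReflection (x ⋏ y) = toReflection x ⊓ toReflection y := rfl

theorem toReflection_join (x y : S) :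
    toReflection (x ⋎ y) = toReflection x ⊔ toReflection y := rfl

variable (S) in
/-- Right distributive skew lattices: normal, right-handed and symmetric skew lattices with a zero
element for `⋏`, whose lattice reflection is a bounded distributive lattice. -/
structure IsRightDistributive : Prop where
  normal : ∀ x y z : S, z ⋏ x ⋏ y ⋏ z = z ⋏ y ⋏ x ⋏ z
  rightHanded : ∀ x y : S, x ⋏ y ⋏ x = y ⋏ x
  symmetric : ∀ x y : S, x ⋏ y = y ⋏ x ↔ x ⋎ y = y ⋎ x
  exists_zero : ∃ z : S, ∀ x : S, z ⋏ x = z ∧ x ⋏ z = z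
  reflection_bounded : Nonempty (BoundedOrder (LatticeReflection S))
  reflection_distrib : ∀ a b c : LatticeReflection S, a ⊓ (b ⊔ c) = (a ⊓ b) ⊔ (a ⊓ c)

end SkewLattice

/-- A right distributive skew lattice over the lattice `L`: a right distributive skew lattice
together with an identification of its lattice reflection with `L`. -/
structure RightDistributiveSkewLatticeOver (L : Type u) [Lattice L] where
  carrier : Type u
  [skewLattice : SkewLattice carrier]
  isRightDistributive : SkewLattice.IsRightDistributive carrier
  reflectionIso : SkewLattice.LatticeReflection carrier ≃o L

namespace RightDistributiveSkewLatticeOver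

attribute [instance] skewLattice

variable {L : Type u} [Lattice L]

/-- The projection `S → S/𝒟 ≅ L`. -/
def proj (S : RightDistributiveSkewLatticeOver L) (x : S.carrier) : L :=
  S.reflectionIso (SkewLattice.toReflection x)

/-- A morphism of skew lattices over `L`. -/
@[ext]
structure Hom (S T : RightDistributiveSkewLatticeOver L) where
  toFun : S.carrier → T.carrier
  map_meet : ∀ x y, toFun (x ⋏ y) = toFun x ⋏ toFun y
  map_join : ∀ x y, toFun (x ⋎ y) = toFun x ⋎ toFun y
  proj_comp : ∀ x, T.proj (toFun x) = S.proj x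

instance : Category (RightDistributiveSkewLatticeOver L) where
  Hom := Hom
  id S := ⟨fun x => x, fun _ _ => rfl, fun _ _ => rfl, fun _ => rfl⟩
  comp f g :=
    { toFun := fun x => g.toFun (f.toFun x)
      map_meet := fun x y => by rw [f.map_meet, g.map_meet]
      map_join := fun x y => by rw [f.map_join, g.map_join]
      proj_comp := fun x => by rw [g.proj_comp, f.proj_comp] }

end RightDistributiveSkewLatticeOver

/-! ## The patch monad -/

/-- The lattice of compact open subsets of a quasi-separated space. -/
instance compactOpensLattice (X : Type u) [TopologicalSpace X] [QuasiSeparatedSpace X] :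
    Lattice (CompactOpens X) where
  inf U V := U ⊓ V
  inf_le_left _ _ := inf_le_left
  inf_le_right _ _ := inf_le_right
  le_inf _ _ _ := le_inf

noncomputable section

section Patch

variable (X : Type u) [TopologicalSpace X] [SpectralSpace X]

/-- The space `X` with its patch (constructible) topology. -/
abbrev patchSpace : TopCat.{u} := TopCat.of (WithConstructibleTopology X)

theorem continuous_patch :
    Continuous (WithTopology.ofTopology : WithConstructibleTopology X → X) := by
  refine (PrespectralSpace.isTopologicalBasis (X := X)).continuous_iff.2 ?_
  rintro U ⟨hU, hU'⟩
  exact WithConstructibleTopology.isOpen_iff.2 (hU'.isOpen_constructibleTopology_of_isOpen hU)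

/-- The patch refinement `φ : Xᵖ ⟶ X`, the identity on points. -/
def patchMap : patchSpace X ⟶ TopCat.of X :=
  TopCat.ofHom ⟨WithTopology.ofTopology, continuous_patch X⟩

/-- The adjunction `φ^* ⊣ φ_*` between sheaves of sets on `X` and on `Xᵖ`. -/
abbrev patchAdjunction :
    TopCat.Sheaf.pullback (Type u) (patchMap X) ⊣ TopCat.Sheaf.pushforward (Type u) (patchMap X) :=
  TopCat.Sheaf.pullbackPushforwardAdjunction (Type u) (patchMap X)

/-- The patch monad `T = φ_* φ^*` on sheaves of sets on `X`. -/
abbrev patchMonad : Monad (TopCat.Sheaf (Type u) (TopCat.of X)) :=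
  (patchAdjunction X).toMonad

/-- A sheaf is global if it has a global section. -/
def IsGlobalSheaf (F : TopCat.Sheaf (Type u) (TopCat.of X)) : Prop :=
  Nonempty (F.1.obj (op ⊤))

/-- The category of global `T`-algebras: `T`-algebras whose underlying sheaf is global. -/
abbrev GlobalPatchAlgebra : Type _ :=
  ObjectProperty.FullSubcategory (fun A : (patchMonad X).Algebra => IsGlobalSheaf X A.A)

variable {X}

/-- A `T`-algebra structure on the sheaf `F`. -/
structure PatchAlgebraStructure (F : TopCat.Sheaf (Type u) (TopCat.of X)) where
  a : (patchMonad X).obj F ⟶ F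
  unit : (patchMonad X).η.app F ≫ a = 𝟙 F
  assoc : (patchMonad X).μ.app F ≫ a = (patchMonad X).map a ≫ a

/-! ## Local sections -/

/-- Local sections of `F` over compact open subsets. -/
def LocalSection (F : TopCat.Sheaf (Type u) (TopCat.of X)) : Type u :=
  Σ U : CompactOpens X, F.1.obj (op (show Opens (TopCat.of X) from U.toOpens))

/-- The band operation `(s, U)(t, V) = (t|_{U ∩ V}, U ∩ V)` on local sections. -/
def LocalSection.meet {F : TopCat.Sheaf (Type u) (TopCat.of X)} (x y : LocalSection F) :
    LocalSection F :=
  ⟨x.1 ⊓ y.1, F.1.map (homOfLE (show (x.1 ⊓ y.1).toOpens ≤ y.1.toOpens from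
    fun _ h => h.2)).op y.2⟩

/-- The action of a morphism of sheaves on local sections. -/
def LocalSection.map {F G : TopCat.Sheaf (Type u) (TopCat.of X)} (f : F ⟶ G)
    (x : LocalSection F) : LocalSection G :=
  ⟨x.1, f.1.app _ x.2⟩

/-- The preimage `φ⁻¹ U`, an open subset of `Xᵖ`. -/
abbrev patchPreimage (U : CompactOpens X) : Opens (patchSpace X) :=
  (Opens.map (patchMap X)).obj U.toOpens

/-- The difference `V \ U` of two compact open subsets of `X`, as an open subset of `Xᵖ`. -/
def patchDiff (V U : CompactOpens X) : Opens (patchSpace X) where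
  carrier := (patchPreimage V : Set (patchSpace X)) \ patchPreimage U
  is_open' := by
    refine (patchPreimage V).isOpen.sdiff ⟨?_⟩
    refine WithConstructibleTopology.isOpen_iff.2 ?_
    refine IsCompact.isOpen_constructibleTopology_of_isClosed (s := (U : Set X)ᶜ) ?_ ?_
    · rw [compl_compl]; exact U.isCompact
    · exact U.isOpen.isClosed_compl

/-- The image of a local section of `F` over `U` under the unit, as a section of `φ^* F` over
`φ⁻¹ U`. -/
def patchSection {F : TopCat.Sheaf (Type u) (TopCat.of X)} (x : LocalSection F) :
    ((TopCat.Sheaf.pullback (Type u) (patchMap X)).obj F).1.obj (op (patchPreimage x.1)) :=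
  ((patchAdjunction X).unit.app F).1.app _ x.2

/-- `IsPatch x y σ`, for `x = (s, U)` and `y = (t, V)`: the section `σ ∈ (T F)(U ∪ V)` is the patch
of `s` on `U` and `t` on `V \ U`, i.e. as a section of `φ^* F` over `φ⁻¹ (U ∪ V)` it restricts to
`s` on `U` and to `t` on `V \ U`. -/
def IsPatch {F : TopCat.Sheaf (Type u) (TopCat.of X)} (x y : LocalSection F)
    (σ : ((TopCat.Sheaf.pullback (Type u) (patchMap X)).obj F).1.obj
      (op (patchPreimage (x.1 ⊔ y.1)))) : Prop :=
  ((TopCat.Sheaf.pullback (Type u) (patchMap X)).obj F).1.map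
      (homOfLE (show patchPreimage x.1 ≤ patchPreimage (x.1 ⊔ y.1) from
        fun _ h => Or.inl h)).op σ = patchSection x ∧
  ((TopCat.Sheaf.pullback (Type u) (patchMap X)).obj F).1.map
      (homOfLE (show patchDiff y.1 x.1 ≤ patchPreimage (x.1 ⊔ y.1) from
        fun _ h => Or.inr h.1)).op σ =
    ((TopCat.Sheaf.pullback (Type u) (patchMap X)).obj F).1.map
      (homOfLE (show patchDiff y.1 x.1 ≤ patchPreimage y.1 from fun _ h => h.1)).op
      (patchSection y)

/-- `IsPatchJoin a x y z`, for `x = (s, U)` and `y = (t, V)`: the local section `z` is the value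
`a (s on U, t on V \ U) ∈ F (U ∪ V)` of the map `a : T F ⟶ F` at the patch of `s` and `t`. -/
def IsPatchJoin {F : TopCat.Sheaf (Type u) (TopCat.of X)} (a : (patchMonad X).obj F ⟶ F)
    (x y z : LocalSection F) : Prop :=
  ∃ σ, IsPatch x y σ ∧ z = ⟨x.1 ⊔ y.1, a.1.app (op (x.1 ⊔ y.1).toOpens) σ⟩

/-- The structures of right distributive skew lattice on the set of local sections of `F` that
extend its band structure. -/
def SkewExtension (F : TopCat.Sheaf (Type u) (TopCat.of X)) : Type u :=
  {S : SkewLattice (LocalSection F) // (∀ x y, S.meet x y = x.meet y) ∧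
    @SkewLattice.IsRightDistributive _ S}

end Patch

end

/-! A section of `T F` over a compact open `U` is a section of `φ^* F` over `U` in the patch
topology. Differences `C \ D` of compact opens form a basis of that topology, and `U` is compact in
it, so the section is given by sections of `F` on finitely many strata. It is built up by enlarging
`W` to `W ∪ V`, where on `V \ W` the section comes from `F` (`patch_section_induction`). An algebra
structure turns this patching into `⋎` (`patch_map`), so it is determined by `⋎`, and the skew
lattice axioms become identities between patches.

Conversely, given `⋎`, the value `w` of a section `y` of `T F` has to satisfy `w|_{K ∪ U} = w|_K ⋎
x` whenever `x`, over `U`, agrees with `y` outside `K`. `IsValue` imposes this for all `K` and `x`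
at once. Uniqueness is then immediate along a stratification; existence says that the result does
not depend on the stratification, and its inductive step is `IsValue.join`. Two facts carry it:
restriction distributes over `⋎` (`meet_join_distrib`), which uses symmetry, and `c ⋎ x` depends
only on the germs of `x` outside the domain of `c` (`join_congr_right`), which uses compactness. The
unit law is `isValue_unit`, and associativity is one more induction along strata.

For the equivalence, preservation of `⋏` makes a map a morphism of sheaves and preservation of `⋎`
makes it a morphism of algebras. A skew lattice over the compact opens is the set of local sections
of its sheaf of compatible families; these glue because the join of two commuting elements restricts
to both. What is needed about stalks of `φ^* F` is read off from the adjunction by mapping into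
sheaves of functions. -/

set_option linter.unusedSectionVars false

/-! ### Restriction and join in right distributive skew lattices -/

namespace SkewLattice

section RightHanded

variable {S : Type u} [SkewLattice S]

theorem toReflection_le_iff_preceq {x y : S} : toReflection x ≤ toReflection y ↔ Preceq x y := by
  rw [← inf_eq_left, ← toReflection_meet]
  constructor
  · intro h
    have h' := (Quotient.exact h).2
    calc x ⋏ y ⋏ x = x ⋏ (x ⋏ y) ⋏ x := by rw [← meet_assoc, meet_idem]
      _ = x := h'
  · intro h
    refine Quotient.sound ⟨?_, ?_⟩
    · show x ⋏ y ⋏ x ⋏ (x ⋏ y) = x ⋏ y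
      rw [show x ⋏ y ⋏ x = x from h, ← meet_assoc, meet_idem]
    · show x ⋏ (x ⋏ y) ⋏ x = x
      rw [← meet_assoc, meet_idem]
      exact h

theorem toReflection_le_iff (hR : ∀ x y : S, x ⋏ y ⋏ x = y ⋏ x) {x y : S} :
    toReflection x ≤ toReflection y ↔ y ⋏ x = x := by
  rw [toReflection_le_iff_preceq, Preceq, hR]

theorem meet_eq_iff_join_eq {x y : S} : y ⋏ x = x ↔ y ⋎ x = y := by
  constructor
  · intro h
    have := join_meet_left y x
    rwa [h] at this
  · intro h
    have := join_meet_right x y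
    rwa [h] at this

theorem toReflection_le_iff_join (hR : ∀ x y : S, x ⋏ y ⋏ x = y ⋏ x) {x y : S} :
    toReflection x ≤ toReflection y ↔ y ⋎ x = y := by
  rw [toReflection_le_iff hR, meet_eq_iff_join_eq]

theorem join_meet_self (hR : ∀ x y : S, x ⋏ y ⋏ x = y ⋏ x) (x y : S) : x ⋎ (y ⋏ x) = x := by
  rw [← hR, meet_assoc, join_meet_left]

end RightHanded

namespace IsRightDistributive

variable {S : Type u} [SkewLattice S] (h : IsRightDistributive S)
include h

theorem join_eq_left {x y : S} (hxy : toReflection x ≤ toReflection y) : y ⋎ x = y :=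
  (toReflection_le_iff_join h.rightHanded).1 hxy

theorem meet_eq_right {x y : S} (hxy : toReflection x ≤ toReflection y) : y ⋏ x = x :=
  (toReflection_le_iff h.rightHanded).1 hxy

/-- The meet depends on its left factor only through the `𝒟`-class. -/
theorem meet_congr_left {u v : S} (huv : toReflection u = toReflection v) (x : S) :
    u ⋏ x = v ⋏ x := by
  have e2 := h.meet_eq_right huv.ge
  -- Right-handedness puts a harmless `x` in front, which gives normality the outer pair it needs to
  -- swap `u` and `v`.
  calc u ⋏ x = x ⋏ v ⋏ u ⋏ x := by
        rw [meet_assoc x v u, h.meet_eq_right huv.le, h.rightHanded]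
    _ = x ⋏ u ⋏ v ⋏ x := h.normal _ _ _
    _ = v ⋏ x := by rw [meet_assoc x u v, e2, h.rightHanded]

/-- An element is determined by its restrictions to a cover by two. -/
theorem ext_of_meet {u v w w' : S} (h1 : u ⋏ w = u ⋏ w') (h2 : v ⋏ w = v ⋏ w')
    (hw : toReflection w ≤ toReflection u ⊔ toReflection v)
    (hw' : toReflection w' ≤ toReflection u ⊔ toReflection v) : w = w' := by
  have key : ∀ w : S, toReflection w ≤ toReflection u ⊔ toReflection v →
      w = u ⋏ w ⋎ v ⋏ w := by
    intro w hw
    have e : u ⋏ w ⋎ v ⋏ w ⋎ w = w := by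
      rw [join_assoc, meet_join_right, meet_join_right]
    -- By distributivity of the reflection the join of the two restrictions lies over at least the
    -- class of `w`, so it also absorbs `w` on the right.
    have e' : u ⋏ w ⋎ v ⋏ w ⋎ w = u ⋏ w ⋎ v ⋏ w := by
      apply h.join_eq_left
      rw [toReflection_join, toReflection_meet, toReflection_meet,
        inf_comm, inf_comm (toReflection v), ← h.reflection_distrib]
      exact le_inf le_rfl hw
    rw [← e', e]
  rw [key w hw, key w' hw', h1, h2]

/-- Symmetry makes the join of commuting elements an extension of both factors, not only of the left
one; this is the gluing of two compatible sections. -/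
theorem meet_join_of_comm {x y : S} (hxy : x ⋏ y = y ⋏ x) : y ⋏ (x ⋎ y) = y := by
  rw [(h.symmetric x y).1 hxy, meet_join_left]

theorem meet_left_comm (u v x : S) : u ⋏ (v ⋏ x) = v ⋏ (u ⋏ x) := by
  rw [← meet_assoc, ← meet_assoc]
  exact h.meet_congr_left (by rw [toReflection_meet, toReflection_meet, inf_comm]) x

/-- Restriction distributes over joins, for an element over which the second factor lives. -/
theorem meet_join_distrib_of_le {y z : S} (x : S)
    (hzy : toReflection z ≤ toReflection y) : z ⋏ (x ⋎ y) = z ⋏ x ⋎ z ⋏ y := by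
  set w := z ⋏ x ⋎ z ⋏ y with hw
  have hdw : toReflection w = toReflection z := by
    rw [hw, toReflection_join, toReflection_meet, toReflection_meet, inf_eq_left.2 hzy,
      sup_eq_right.2 inf_le_left]
  -- Both products equal `z ⋏ x`. Symmetry then lets `w` move to the front of `x ⋎ w ⋎ y`, where `w`
  -- absorbs the join; and that join is `x ⋎ y`, because `x` absorbs `z ⋏ x` and `y` absorbs `z ⋏
  -- y`.
  have hxw : x ⋏ w = w ⋏ x := by
    rw [h.meet_congr_left hdw x]
    calc x ⋏ w = x ⋏ (w ⋏ w) := by rw [meet_idem]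
      _ = (z ⋏ x) ⋏ w := by
        rw [← meet_assoc]
        apply h.meet_congr_left
        rw [toReflection_meet, toReflection_meet, hdw, inf_comm]
      _ = z ⋏ x := by rw [hw, meet_join_left]
  have e : x ⋎ y = x ⋎ w ⋎ y := by
    rw [hw, ← join_assoc, join_meet_self h.rightHanded, join_assoc, meet_join_right]
  have e1 : w ⋏ (x ⋎ w ⋎ y) = w := by
    rw [(h.symmetric x w).1 hxw, join_assoc, meet_join_left]
  rw [h.meet_congr_left hdw.symm, e, e1]

/-- Restriction distributes over joins. -/
theorem meet_join_distrib (x y z : S) : z ⋏ (x ⋎ y) = z ⋏ x ⋎ z ⋏ y := by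
  have hw : ∀ u : S, u ⋏ (z ⋏ x ⋎ z ⋏ y) = (u ⋏ z) ⋏ (z ⋏ x ⋎ z ⋏ y) := by
    intro u
    rw [meet_assoc, h.meet_eq_right (x := z ⋏ x ⋎ z ⋏ y) (y := z)]
    change toReflection (z ⋏ x) ⊔ toReflection (z ⋏ y) ≤ _
    rw [toReflection_meet, toReflection_meet]
    exact sup_le inf_le_left inf_le_left
  -- The two sides are compared over `x` and over `y`. Over `x` a join is its left factor; over `y`
  -- the special case applies, to the class of `y ⋏ z`.
  refine h.ext_of_meet (u := x) (v := y) ?_ ?_ ?_ ?_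
  · rw [h.meet_left_comm, meet_join_left, hw,
      h.meet_congr_left (u := x ⋏ z) (v := z ⋏ x), meet_join_left]
    rw [toReflection_meet, toReflection_meet, inf_comm]
  · rw [hw, ← meet_assoc, h.meet_join_distrib_of_le x, h.meet_join_distrib_of_le (z ⋏ x),
      show ∀ a, y ⋏ z ⋏ (z ⋏ a) = y ⋏ z ⋏ a from fun a => by
        rw [meet_assoc y z, ← meet_assoc z z, meet_idem, ← meet_assoc],
      show ∀ a, y ⋏ z ⋏ (z ⋏ a) = y ⋏ z ⋏ a from fun a => by
        rw [meet_assoc y z, ← meet_assoc z z, meet_idem, ← meet_assoc]]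
    · rw [toReflection_meet, toReflection_meet, inf_comm]
    · rw [toReflection_meet]
      exact inf_le_left
  · rw [toReflection_meet, toReflection_join]
    exact inf_le_right
  · rw [toReflection_join, toReflection_meet, toReflection_meet]
    exact sup_le_sup inf_le_right inf_le_right

end IsRightDistributive
end SkewLattice

/-! ### Local sections over compact opens and morphisms of sheaves -/

noncomputable section

namespace LocalSection

variable {X : Type u} [TopologicalSpace X] [SpectralSpace X]
variable {F G H : TopCat.Sheaf (Type u) (TopCat.of X)}

theorem eq_of_map_eq {x y : LocalSection F} (h : x.1 = y.1)
    (h' : F.1.map (homOfLE (show x.1.toOpens ≤ y.1.toOpens from h.le)).op y.2 = x.2) : x = y := by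
  obtain ⟨U, s⟩ := x
  obtain ⟨V, t⟩ := y
  obtain rfl : U = V := h
  congr 1
  exact h'.symm.trans (ConcreteCategory.congr_hom (F.1.map_id _) t)

/-- The section of `x` over a smaller compact open set. -/
def sec (x : LocalSection F) (K : CompactOpens X) (h : K ≤ x.1) :
    F.1.obj (op (show Opens (TopCat.of X) from K.toOpens)) :=
  F.1.map (homOfLE (show K.toOpens ≤ x.1.toOpens from h)).op x.2

/-- The restriction of a local section to the intersection of its domain with `K`. -/
def res (x : LocalSection F) (K : CompactOpens X) : LocalSection F :=
  ⟨K ⊓ x.1, x.sec (K ⊓ x.1) inf_le_right⟩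

@[simp] theorem res_fst (x : LocalSection F) (K : CompactOpens X) : (x.res K).1 = K ⊓ x.1 := rfl

theorem map_map_apply {U V W : (Opens (TopCat.of X))ᵒᵖ} (f : U ⟶ V) (g : V ⟶ W) (h : U ⟶ W)
    (s : F.1.obj U) : F.1.map g (F.1.map f s) = F.1.map h s := by
  rw [← ConcreteCategory.comp_apply, ← F.1.map_comp]
  rfl

theorem mk_sec (x : LocalSection F) (K : CompactOpens X) (h : K ≤ x.1) :
    (⟨K, x.sec K h⟩ : LocalSection F) = x.res K :=
  eq_of_map_eq (inf_eq_left.2 h).symm (map_map_apply _ _ _ _)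

theorem res_res (x : LocalSection F) (K L : CompactOpens X) :
    (x.res K).res L = x.res (L ⊓ K) :=
  eq_of_map_eq (inf_assoc _ _ _).symm <|
    (map_map_apply _ _ (homOfLE fun _ h => h.2.2).op _).trans (map_map_apply _ _ _ _).symm

theorem res_eq_self (x : LocalSection F) {K : CompactOpens X} (h : x.1 ≤ K) : x.res K = x :=
  eq_of_map_eq (inf_eq_right.2 h) rfl

theorem res_inf_fst (x : LocalSection F) (K : CompactOpens X) : x.res (K ⊓ x.1) = x.res K := by
  rw [← res_res, res_eq_self x le_rfl]

theorem res_congr (x : LocalSection F) {K L : CompactOpens X} (h : K ⊓ x.1 = L ⊓ x.1) :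
    x.res K = x.res L := by
  rw [← res_inf_fst, h, res_inf_fst]

theorem meet_eq_res (x y : LocalSection F) : x.meet y = y.res x.1 := rfl

@[simp] theorem map_fst (f : F ⟶ G) (x : LocalSection F) : (x.map f).1 = x.1 := rfl

theorem map_res (f : F ⟶ G) (x : LocalSection F) (K : CompactOpens X) :
    (x.res K).map f = (x.map f).res K :=
  Sigma.ext rfl (heq_of_eq (NatTrans.naturality_apply f.1 _ _))

theorem map_comp (f : F ⟶ G) (g : G ⟶ H) (x : LocalSection F) :
    x.map (f ≫ g) = (x.map f).map g := rfl

theorem eq_iff_sec_eq {x y : LocalSection F} {K : CompactOpens X} (hx : K ≤ x.1) (hy : K ≤ y.1) :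
    x.res K = y.res K ↔ x.sec K hx = y.sec K hy := by
  rw [← mk_sec x K hx, ← mk_sec y K hy]
  constructor
  · intro h
    have := (Sigma.mk.inj_iff.1 h).2
    exact eq_of_heq this
  · intro h
    rw [h]

/-- Local sections with the same domain that agree locally are equal. -/
theorem ext_of_locally {x y : LocalSection F} (h : x.1 = y.1)
    (hl : ∀ p ∈ x.1, ∃ K : CompactOpens X, p ∈ K ∧ x.res K = y.res K) : x = y := by
  refine eq_of_map_eq h (TopCat.Presheaf.IsSheaf.section_ext (F := F.1) F.2 fun p hp => ?_)
  obtain ⟨K, hpK, hK⟩ := hl p hp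
  have hle : K ⊓ x.1 ≤ y.1 := h ▸ inf_le_right
  refine ⟨(K ⊓ x.1).toOpens, fun q hq => hq.2, ⟨hpK, hp⟩, ?_⟩
  refine (map_map_apply _ _ (homOfLE hle).op _).trans ?_
  refine ((eq_iff_sec_eq (x := x) (y := y) inf_le_right hle).1 ?_).symm
  rw [res_inf_fst, h, res_inf_fst, hK]

theorem ext_of_bot {x y : LocalSection F} (hx : x.1 = ⊥) (hy : y.1 = ⊥) : x = y :=
  ext_of_locally (hx.trans hy.symm) fun _ hp => by
    rw [hx] at hp
    exact hp.elim

/-- Local sections that agree on a cover by two are equal. -/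
theorem ext_of_cover {x y : LocalSection F} {K L : CompactOpens X} (hx : x.1 ≤ K ⊔ L)
    (hxy : x.1 = y.1) (h1 : x.res K = y.res K) (h2 : x.res L = y.res L) : x = y :=
  ext_of_locally hxy fun _ hp => (hx hp).elim (fun h => ⟨K, h, h1⟩) fun h => ⟨L, h, h2⟩

variable (X) in
theorem isBasis_compactOpens :
    Opens.IsBasis (Set.range fun K : CompactOpens X =>
      (show Opens (TopCat.of X) from K.toOpens)) := by
  convert! PrespectralSpace.isBasis_opens X
  ext U
  constructor
  · rintro ⟨K, rfl⟩
    exact K.isCompact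
  · intro hU
    exact ⟨⟨⟨U, hU⟩, U.isOpen⟩, rfl⟩

theorem exists_compactOpens {U : Opens X} {p : X} (hp : p ∈ U) :
    ∃ K : CompactOpens X, p ∈ K ∧ K.toOpens ≤ U := by
  obtain ⟨_, ⟨K, rfl⟩, hK, hKU⟩ := (Opens.isBasis_iff_nbhd.1 (isBasis_compactOpens X)) hp
  exact ⟨K, hK, hKU⟩

/-- A morphism of sheaves is determined by its action on local sections. -/
theorem hom_ext {f g : F ⟶ G} (h : ∀ x : LocalSection F, x.map f = x.map g) : f = g := by
  apply Sheaf.hom_ext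
  refine TopCat.Sheaf.hom_ext F.1 G (isBasis_compactOpens X) fun K => ?_
  ext s
  exact eq_of_heq (Sigma.mk.inj_iff.1 (h ⟨K, s⟩)).2

/-- A map of local sections that is compatible with restriction comes from a morphism of
sheaves. -/
theorem exists_hom (f : LocalSection F → LocalSection G) (h1 : ∀ x, (f x).1 = x.1)
    (h2 : ∀ x K, f (x.res K) = (f x).res K) : ∃ g : F ⟶ G, ∀ x, x.map g = f x := by
  have h3 : ∀ (K : CompactOpens X) (s : F.1.obj (op K.toOpens)),
      ∃ t : G.1.obj (op K.toOpens), f ⟨K, s⟩ = ⟨K, t⟩ := by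
    intro K s
    have := h1 ⟨K, s⟩
    generalize f ⟨K, s⟩ = y at this
    obtain ⟨L, t⟩ := y
    obtain rfl : L = K := this
    exact ⟨t, rfl⟩
  choose a ha using h3
  let B : CompactOpens X → Opens (TopCat.of X) := fun K => K.toOpens
  let α : (inducedFunctor B).op ⋙ F.1 ⟶ (inducedFunctor B).op ⋙ G.1 :=
    { app := fun K => TypeCat.ofHom (a K.unop)
      naturality := by
        intro K L i
        ext s
        let K' : CompactOpens X := K.unop
        let L' : CompactOpens X := L.unop
        have hle : L' ≤ K' := leOfHom i.unop.hom
        have e := h2 ⟨K', s⟩ L'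
        have e1 : (⟨L', a L' (sec ⟨K', s⟩ L' hle)⟩ : LocalSection G) =
            ⟨L', sec ⟨K', a K' s⟩ L' hle⟩ := by
          refine (ha _ _).symm.trans ?_
          refine (congrArg f (mk_sec _ _ _)).trans (e.trans ?_)
          refine (congrArg (fun z => res z L') (ha _ _)).trans ?_
          exact (mk_sec _ _ _).symm
        exact eq_of_heq (Sigma.mk.inj_iff.1 e1).2 }
  refine ⟨ObjectProperty.homMk (TopCat.Sheaf.restrictHomEquivHom F.1 G
    (isBasis_compactOpens X) α), ?_⟩
  rintro ⟨K, s⟩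
  rw [ha]
  refine Sigma.ext rfl (heq_of_eq ?_)
  exact ConcreteCategory.congr_hom
    (TopCat.Sheaf.extend_hom_app F.1 G (isBasis_compactOpens X) α K) s

/-- This is where globality enters: with an element over every compact open, each restriction `x.res
K` is a meet `k ⋏ x`, so it is visible to the skew lattice. -/
theorem exists_res_eq (hF : IsGlobalSheaf X F) (K : CompactOpens X) :
    ∃ x : LocalSection F, x.1 = K := by
  obtain ⟨s⟩ := hF
  exact ⟨⟨K, F.1.map (homOfLE le_top).op s⟩, rfl⟩

end LocalSection
end

/-! ### Germs of sections of `φ^* F` -/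

noncomputable section

/-- A family of functions on stalks, as a morphism to a sheaf of dependent functions. -/
def TopCat.Sheaf.toFunctions {Y : TopCat.{u}} (Q : TopCat.Sheaf (Type u) Y) (T : Y → Type u)
    (f : ∀ p : Y, Q.presheaf.stalk p → T p) : Q ⟶ TopCat.sheafToTypes Y T :=
  ObjectProperty.homMk
    { app := fun N => TypeCat.ofHom fun σ p => f p.1 (Q.presheaf.germ N.unop p.1 p.2 σ)
      naturality := by
        intro N M i
        ext σ
        funext p
        exact congrArg (f p.1) (TopCat.Presheaf.germ_res_apply Q.presheaf i.unop p.1 p.2 σ) }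

section

variable {X : Type u} [TopologicalSpace X] [SpectralSpace X]
variable {F G : TopCat.Sheaf (Type u) (TopCat.of X)}

variable (X) in
/-- A point of `X`, as a point of the patch space. -/
abbrev patchPoint (p : X) : patchSpace X := WithTopology.toTopology _ p

/-- The germ at a point of the patch space of a local section of `T F`. -/
def patchGerm (y : LocalSection ((patchMonad X).obj F)) (p : X) (hp : p ∈ y.1) :
    ((TopCat.Sheaf.pullback (Type u) (patchMap X)).obj F).presheaf.stalk (patchPoint X p) :=
  TopCat.Presheaf.germ ((TopCat.Sheaf.pullback (Type u) (patchMap X)).obj F).presheaf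
    (patchPreimage y.1) (patchPoint X p) hp y.2

/-- Two local sections of `T F` have the same germ at a point, as sections of `φ^* F`. -/
def AgreeAt (y z : LocalSection ((patchMonad X).obj F)) (p : X) : Prop :=
  ∃ hy hz, patchGerm y p hy = patchGerm z p hz

/-- The image of a local section under the unit of the patch monad. -/
abbrev LocalSection.unit (x : LocalSection F) : LocalSection ((patchMonad X).obj F) :=
  x.map ((patchMonad X).η.app F)

theorem patchGerm_res (y : LocalSection ((patchMonad X).obj F)) (K : CompactOpens X) (p : X)
    (hp : p ∈ (y.res K).1) : patchGerm (y.res K) p hp = patchGerm y p hp.2 :=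
  TopCat.Presheaf.germ_res_apply
    ((TopCat.Sheaf.pullback (Type u) (patchMap X)).obj F).presheaf
    (homOfLE (show patchPreimage (K ⊓ y.1) ≤ patchPreimage y.1 from fun _ h => h.2))
    (patchPoint X p) hp y.2

namespace AgreeAt

variable {y z w : LocalSection ((patchMonad X).obj F)} {p : X}

theorem symm (h : AgreeAt y z p) : AgreeAt z y p :=
  let ⟨hy, hz, e⟩ := h
  ⟨hz, hy, e.symm⟩

theorem trans (h : AgreeAt y z p) (h' : AgreeAt z w p) : AgreeAt y w p :=
  let ⟨hy, _, e⟩ := h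
  let ⟨_, hw, e'⟩ := h'
  ⟨hy, hw, e.trans e'⟩

theorem refl (hp : p ∈ y.1) : AgreeAt y y p := ⟨hp, hp, rfl⟩

theorem res (y : LocalSection ((patchMonad X).obj F)) {K : CompactOpens X} (hp : p ∈ K)
    (hy : p ∈ y.1) : AgreeAt (y.res K) y p :=
  ⟨⟨hp, hy⟩, hy, patchGerm_res _ _ _ _⟩

/-- Morphisms induced by morphisms of sheaves on the patch space preserve agreement. -/
theorem map_pushforward (h : AgreeAt y z p)
    (g : (TopCat.Sheaf.pullback (Type u) (patchMap X)).obj F ⟶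
      (TopCat.Sheaf.pullback (Type u) (patchMap X)).obj G) :
    AgreeAt (F := G)
      (LocalSection.map ((TopCat.Sheaf.pushforward (Type u) (patchMap X)).map g) y)
      (LocalSection.map ((TopCat.Sheaf.pushforward (Type u) (patchMap X)).map g) z) p := by
  obtain ⟨hy, hz, e⟩ := h
  have key : ∀ (y : LocalSection ((patchMonad X).obj F)) (hy : p ∈ y.1),
      (TopCat.Presheaf.stalkFunctor (Type u) (patchPoint X p)).map g.1 (patchGerm y p hy) =
      patchGerm (F := G)
        (LocalSection.map ((TopCat.Sheaf.pushforward (Type u) (patchMap X)).map g) y) p hy :=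
    fun y hy => TopCat.Presheaf.stalkFunctor_map_germ_apply (patchPreimage y.1)
      (patchPoint X p) hy g.1 y.2
  exact ⟨hy, hz, by rw [← key, ← key, e]⟩

theorem map_map (h : AgreeAt y z p) (f : F ⟶ G) :
    AgreeAt (y.map ((patchMonad X).map f)) (z.map ((patchMonad X).map f)) p :=
  h.map_pushforward ((TopCat.Sheaf.pullback (Type u) (patchMap X)).map f)

theorem map_mu {y z : LocalSection ((patchMonad X).obj ((patchMonad X).obj F))}
    (h : AgreeAt y z p) :
    AgreeAt (y.map ((patchMonad X).μ.app F)) (z.map ((patchMonad X).μ.app F)) p :=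
  h.map_pushforward ((patchAdjunction X).counit.app _)

end AgreeAt

namespace LocalSection

theorem unit_res (x : LocalSection F) (K : CompactOpens X) : (x.res K).unit = x.unit.res K :=
  map_res _ _ _

theorem unit_naturality (f : F ⟶ G) (x : LocalSection F) :
    x.unit.map ((patchMonad X).map f) = (x.map f).unit := by
  rw [unit, unit, ← map_comp, ← map_comp, ← (patchMonad X).η.naturality]
  rfl

theorem mu_unit (y : LocalSection ((patchMonad X).obj F)) :
    y.unit.map ((patchMonad X).μ.app F) = y := by
  rw [unit, ← map_comp, (patchMonad X).left_unit]
  rfl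

/-- Local sections of `T F` that agree at all points are equal. -/
theorem ext_of_agreeAt {y z : LocalSection ((patchMonad X).obj F)} (h : y.1 = z.1)
    (h' : ∀ p ∈ y.1, AgreeAt y z p) : y = z := by
  obtain ⟨U, s⟩ := y
  obtain ⟨V, t⟩ := z
  obtain rfl : U = V := h
  congr 1
  refine TopCat.Presheaf.section_ext ((TopCat.Sheaf.pullback (Type u) (patchMap X)).obj F)
    (patchPreimage U) s t fun p hp => ?_
  obtain ⟨_, _, e⟩ := h' p.ofTopology hp
  exact e

/-- Every germ of `φ^* F` comes from a local section of `F`. -/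
theorem exists_patchGerm_unit_eq (p : X)
    (a : ((TopCat.Sheaf.pullback (Type u) (patchMap X)).obj F).presheaf.stalk (patchPoint X p)) :
    ∃ (x : LocalSection F) (hp : p ∈ x.unit.1), patchGerm x.unit p hp = a := by
  let Q := (TopCat.Sheaf.pullback (Type u) (patchMap X)).obj F
  -- Two truth-valued functions on germs are compared: `α` is constantly true, `β` says that the
  -- germ comes from `F`. They agree after composition with the unit, hence are equal by adjunction.
  let α : Q ⟶ TopCat.sheafToTypes (patchSpace X) (fun _ => ULift.{u} Prop) :=
    Q.toFunctions _ fun _ _ => ⟨True⟩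
  let β : Q ⟶ TopCat.sheafToTypes (patchSpace X) (fun _ => ULift.{u} Prop) :=
    Q.toFunctions _ fun q b =>
      ⟨∃ (x : LocalSection F) (hp : q.ofTopology ∈ x.unit.1), patchGerm x.unit q.ofTopology hp = b⟩
  have hαβ : α = β := by
    apply ((patchAdjunction X).homEquiv _ _).injective
    rw [Adjunction.homEquiv_unit, Adjunction.homEquiv_unit]
    refine hom_ext fun x => Sigma.ext rfl (heq_of_eq ?_)
    funext q
    refine congrArg ULift.up (eq_true ?_).symm
    exact ⟨x, q.2, rfl⟩
  obtain ⟨N, hN, σ, rfl⟩ := TopCat.Presheaf.exists_germ_eq Q.presheaf a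
  have := congrArg (fun f : Q ⟶ TopCat.sheafToTypes (patchSpace X) (fun _ => ULift.{u} Prop) =>
    f.1.app (op N) σ ⟨patchPoint X p, hN⟩) hαβ
  exact of_eq_true (congrArg ULift.down this).symm

/-- Local sections of `F` whose images in `φ^* F` have the same germ at a point agree on a
neighbourhood of the point in `X`. -/
theorem exists_res_eq_of_agreeAt {x y : LocalSection F} {p : X} (h : AgreeAt x.unit y.unit p) :
    ∃ K : CompactOpens X, p ∈ K ∧ x.res K = y.res K := by
  -- The map `g` sends a section to its family of germs in `F`. Its transpose `γ` recovers these
  -- germs from the image in `φ^* F`, so equal germs there force equal germs in `F`.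
  let T : patchSpace X → Type u := fun q => F.presheaf.stalk (q.ofTopology : TopCat.of X)
  let g : F ⟶ (TopCat.Sheaf.pushforward (Type u) (patchMap X)).obj
      (TopCat.sheafToTypes (patchSpace X) T) :=
    ObjectProperty.homMk
    { app := fun U => TypeCat.ofHom fun s q => F.presheaf.germ U.unop q.1.ofTopology q.2 s
      naturality := by
        intro U V i
        ext s
        funext q
        exact TopCat.Presheaf.germ_res_apply F.presheaf i.unop q.1.ofTopology q.2 s }
  let γ := ((patchAdjunction X).homEquiv _ _).symm g
  have hγ : (patchAdjunction X).unit.app F ≫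
      (TopCat.Sheaf.pushforward (Type u) (patchMap X)).map γ = g :=
    ((patchAdjunction X).homEquiv_unit _ _ _).symm.trans (Equiv.apply_symm_apply _ _)
  obtain ⟨hx, hy, e⟩ := h
  obtain ⟨N, hpN, iU, iV, e'⟩ := TopCat.Presheaf.germ_eq _ _ _ _ _ _ e
  have e1 := congrArg (fun s => γ.1.app (op N) s ⟨patchPoint X p, hpN⟩) e'
  have key : ∀ (x : LocalSection F) (hp : p ∈ x.1) (i : N ⟶ patchPreimage x.1),
      γ.1.app (op N) (((TopCat.Sheaf.pullback (Type u) (patchMap X)).obj F).1.map i.op x.unit.2)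
        ⟨patchPoint X p, hpN⟩ = F.presheaf.germ x.1.toOpens p hp x.2 := by
    intro x hp i
    have h1 := congrFun (NatTrans.naturality_apply γ.1 i.op x.unit.2) ⟨patchPoint X p, hpN⟩
    refine h1.trans ?_
    have h2 := congrArg (fun f : F ⟶ (TopCat.Sheaf.pushforward (Type u) (patchMap X)).obj
      (TopCat.sheafToTypes (patchSpace X) T) => f.1.app (op x.1.toOpens) x.2
        ⟨patchPoint X p, hp⟩) hγ
    exact h2
  have e2 := (key x hx iU).symm.trans (e1.trans (key y hy iV))
  obtain ⟨_, hpW, ⟨K, rfl⟩, hKx, hKy, e3⟩ :=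
    TopCat.Presheaf.germ_eq_of_isBasis (isBasis_compactOpens X) F.presheaf p hx hy e2
  exact ⟨K, hpW, (eq_iff_sec_eq hKx hKy).2 e3⟩

end LocalSection
end
end

/-! ### Stratification in the patch topology, and patching -/

noncomputable section

variable {X : Type u} [TopologicalSpace X] [SpectralSpace X]
variable {F G : TopCat.Sheaf (Type u) (TopCat.of X)}

/-- The differences of compact open subsets form a basis of the patch topology. -/
theorem exists_patchDiff_le {N : Opens (patchSpace X)} {p : X} (hp : patchPoint X p ∈ N) :
    ∃ C D : CompactOpens X, p ∈ C ∧ p ∉ D ∧ ∀ q ∈ C, q ∉ D → patchPoint X q ∈ N := by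
  have h : ∀ s : Set X, @IsOpen X (constructibleTopology X) s → ∀ p ∈ s,
      ∃ C D : CompactOpens X, p ∈ C ∧ p ∉ D ∧ ∀ q ∈ C, q ∉ D → q ∈ s := by
    intro s hs
    induction hs with
    | basic s hs =>
      intro p hp
      rcases hs with hs | hs
      · exact ⟨⟨⟨s, hs.2⟩, hs.1⟩, ⊥, hp, fun h => h, fun q hq _ => hq⟩
      · exact ⟨⊤, ⟨⟨sᶜ, hs.2⟩, hs.1.isOpen_compl⟩, trivial, fun h => h hp,
          fun q _ hq => not_not.1 hq⟩
    | univ => exact fun p _ => ⟨⊤, ⊥, trivial, fun h => h, fun _ _ _ => trivial⟩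
    | inter s t _ _ ihs iht =>
      rintro p ⟨hps, hpt⟩
      obtain ⟨C, D, hC, hD, h⟩ := ihs p hps
      obtain ⟨C', D', hC', hD', h'⟩ := iht p hpt
      exact ⟨C ⊓ C', D ⊔ D', ⟨hC, hC'⟩, fun h => h.elim hD hD', fun q hq hq' =>
        ⟨h q hq.1 fun hh => hq' (Or.inl hh), h' q hq.2 fun hh => hq' (Or.inr hh)⟩⟩
    | sUnion S _ ih =>
      rintro p ⟨s, hs, hp⟩
      obtain ⟨C, D, hC, hD, h⟩ := ih s hs p hp
      exact ⟨C, D, hC, hD, fun q hq hq' => ⟨s, hs, h q hq hq'⟩⟩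
  exact h _ (WithConstructibleTopology.isOpen_iff.1 N.isOpen) p hp

/-- Induction along a stratification of a compact open set: a property of compact open sets that
locally in the patch topology passes to larger sets holds for the whole set. -/
theorem patch_induction {P : CompactOpens X → Prop} (U : CompactOpens X) (h0 : P ⊥)
    (hloc : ∀ p ∈ U, ∃ C D : CompactOpens X, p ∈ C ∧ p ∉ D ∧
      ∀ W V : CompactOpens X, W ≤ U → V ≤ U → V ≤ C → V ⊓ D ≤ W → P W → P (W ⊔ V)) : P U := by
  choose! C D hC hD hstep using hloc
  have hcl : IsClosed (patchPreimage U : Set (patchSpace X)) := by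
    refine ⟨?_⟩
    convert! (patchDiff ⊤ U).isOpen
    ext q
    exact ⟨fun h => ⟨trivial, h⟩, fun h => h.2⟩
  -- `U` is closed in the compact patch space, so finitely many strata `C i \ D i` cover it.
  obtain ⟨t, ht⟩ := hcl.isCompact.elim_finite_subcover
    (fun i : U => (patchDiff (C i) (D i) : Set (patchSpace X)))
    (fun i => (patchDiff (C i) (D i)).isOpen)
    (fun q hq => Set.mem_iUnion.2 ⟨⟨q.ofTopology, hq⟩, hC _ hq, hD _ hq⟩)
  -- Induction on the set of strata needed to cover `Z \ W`; both ends vary because the inductive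
  -- hypothesis is used on two different pairs.
  have key : ∀ t : Finset U, ∀ W Z : CompactOpens X, W ≤ Z → Z ≤ U →
      (∀ q ∈ Z, q ∉ W → ∃ i ∈ t, q ∈ C i ∧ q ∉ D i) → P W → P Z := by
    classical
    intro t
    induction t using Finset.induction with
    | empty =>
      intro W Z hWZ _ h hW
      have : W = Z := le_antisymm hWZ fun q hq => by
        by_contra hq'
        obtain ⟨i, hi, _⟩ := h q hq hq'
        exact absurd hi (Finset.notMem_empty i)
      exact this ▸ hW
    | insert i t _ ih =>
      intro W Z hWZ hZU h hW
      -- The stratum of `i` does not meet `D i`, so the other strata suffice to reach `Z ⊓ D i`.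
      -- Once that part is included, `Z ⊓ C i` can be attached, and what remains is again covered by
      -- the other strata.
      have h1 : P (W ⊔ Z ⊓ D i) := by
        refine ih W _ le_sup_left (sup_le (hWZ.trans hZU) (inf_le_left.trans hZU)) ?_ hW
        intro q hq hqW
        have hq := hq.resolve_left hqW
        obtain ⟨j, hj, hj'⟩ := h q hq.1 hqW
        rcases Finset.mem_insert.1 hj with rfl | hj
        · exact absurd hq.2 hj'.2
        · exact ⟨j, hj, hj'⟩
      have h2 : P (W ⊔ Z ⊓ D i ⊔ Z ⊓ C i) :=
        hstep i i.2 _ _ (sup_le (hWZ.trans hZU) (inf_le_left.trans hZU)) (inf_le_left.trans hZU)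
          inf_le_right (fun q hq => Or.inr ⟨hq.1.1, hq.2⟩) h1
      refine ih _ Z (sup_le (sup_le hWZ inf_le_left) inf_le_left) hZU ?_ h2
      intro q hq hqW
      obtain ⟨j, hj, hj'⟩ := h q hq fun hh => hqW (Or.inl (Or.inl hh))
      rcases Finset.mem_insert.1 hj with rfl | hj
      · exact absurd (Or.inr ⟨hq, hj'.1⟩) hqW
      · exact ⟨j, hj, hj'⟩
  refine key t ⊥ U bot_le le_rfl (fun q hq _ => ?_) h0
  obtain ⟨i, hi, hq'⟩ := Set.mem_iUnion₂.1 (ht (show patchPoint X q ∈ patchPreimage U from hq))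
  exact ⟨i, hi, hq'⟩

namespace LocalSection

/-- Locally in the patch topology, a local section of `T F` comes from a local section of `F`. -/
theorem exists_agreeAt_unit (y : LocalSection ((patchMonad X).obj F)) {p : X} (hp : p ∈ y.1) :
    ∃ (x : LocalSection F) (D : CompactOpens X), p ∈ x.1 ∧ p ∉ D ∧ x.1 ≤ y.1 ∧
      ∀ q ∈ x.1, q ∉ D → AgreeAt y x.unit q := by
  obtain ⟨x, hx, e⟩ := exists_patchGerm_unit_eq p (patchGerm y p hp)
  obtain ⟨N, hpN, iU, iV, e'⟩ := TopCat.Presheaf.germ_eq _ _ _ _ _ _ e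
  obtain ⟨C, D, hC, hD, hN⟩ := exists_patchDiff_le hpN
  refine ⟨x.res (C ⊓ y.1), D, ⟨⟨hC, hp⟩, hx⟩, hD, fun q hq => hq.1.2, fun q hq hq' => ?_⟩
  have hqN := hN q hq.1.1 hq'
  rw [unit_res]
  refine (AgreeAt.trans (AgreeAt.res x.unit hq.1 hq.2) ?_).symm
  refine ⟨hq.2, hq.1.2, ?_⟩
  let Q := (TopCat.Sheaf.pullback (Type u) (patchMap X)).obj F
  have := congrArg (Q.presheaf.germ N (patchPoint X q) hqN) e'
  exact (TopCat.Presheaf.germ_res_apply Q.presheaf iU _ hqN x.unit.2).symm.trans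
    (this.trans (TopCat.Presheaf.germ_res_apply Q.presheaf iV _ hqN y.2))

/-- The domain of `y` and its complement in the domain of `z` are disjoint and open in the patch
topology, so the gluing condition is vacuous. -/
theorem exists_patch (y z : LocalSection ((patchMonad X).obj F)) :
    ∃ w : LocalSection ((patchMonad X).obj F), w.1 = y.1 ⊔ z.1 ∧ (∀ p ∈ y.1, AgreeAt w y p) ∧
      ∀ p ∈ z.1, p ∉ y.1 → AgreeAt w z p := by
  let Q := (TopCat.Sheaf.pullback (Type u) (patchMap X)).obj F
  let N : Bool → Opens (patchSpace X) := fun b => b.rec (patchDiff z.1 y.1) (patchPreimage y.1)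
  let i : ∀ b, N b ⟶ patchPreimage (y.1 ⊔ z.1) := fun b =>
    match b with
    | true => homOfLE fun _ h => Or.inl h
    | false => homOfLE fun _ h => Or.inr h.1
  let s : ∀ b, Q.1.obj (op (N b)) := fun b =>
    match b with
    | true => y.2
    | false => Q.1.map (homOfLE (show patchDiff z.1 y.1 ≤ patchPreimage z.1 from
        fun _ h => h.1)).op z.2
  obtain ⟨σ, hσ, -⟩ := Q.existsUnique_gluing' N (patchPreimage (y.1 ⊔ z.1)) i
    (by
      rintro p hp
      rw [Opens.mem_iSup]
      by_cases h : p ∈ patchPreimage y.1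
      · exact ⟨true, h⟩
      · exact ⟨false, Or.resolve_left hp h, h⟩) s
    (by
      rintro (_ | _) (_ | _)
      · rfl
      · exact TopCat.Presheaf.section_ext Q _ _ _ fun p hp => absurd hp.2 hp.1.2
      · exact TopCat.Presheaf.section_ext Q _ _ _ fun p hp => absurd hp.1 hp.2.2
      · rfl)
  refine ⟨⟨y.1 ⊔ z.1, σ⟩, rfl, fun p hp => ⟨Or.inl hp, hp, ?_⟩, fun p hp hp' =>
    ⟨Or.inr hp, hp, ?_⟩⟩
  · have := congrArg (Q.presheaf.germ (patchPreimage y.1) (patchPoint X p) hp) (hσ true)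
    exact (TopCat.Presheaf.germ_res_apply Q.presheaf (i true) _ hp σ).symm.trans this
  · have := congrArg (Q.presheaf.germ (patchDiff z.1 y.1) (patchPoint X p) ⟨hp, hp'⟩) (hσ false)
    refine (TopCat.Presheaf.germ_res_apply Q.presheaf (i false) _ ⟨hp, hp'⟩ σ).symm.trans
      (this.trans ?_)
    exact TopCat.Presheaf.germ_res_apply Q.presheaf _ (patchPoint X p) _ z.2

/-- The section of `T F` that is `y` on the domain of `y` and `z` elsewhere. -/
def patch (y z : LocalSection ((patchMonad X).obj F)) : LocalSection ((patchMonad X).obj F) :=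
  (exists_patch y z).choose

section

variable (y z : LocalSection ((patchMonad X).obj F))

@[simp] theorem patch_fst : (patch y z).1 = y.1 ⊔ z.1 := (exists_patch y z).choose_spec.1

variable {y z} {p : X}

theorem mem_patch : p ∈ (patch y z).1 ↔ p ∈ y.1 ∨ p ∈ z.1 := by
  rw [patch_fst]
  rfl

theorem patch_left (hp : p ∈ y.1) : AgreeAt (patch y z) y p :=
  (exists_patch y z).choose_spec.2.1 p hp

theorem patch_right (hp : p ∈ z.1) (hp' : p ∉ y.1) : AgreeAt (patch y z) z p :=
  (exists_patch y z).choose_spec.2.2 p hp hp'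

theorem eq_patch {w : LocalSection ((patchMonad X).obj F)} (h : w.1 = y.1 ⊔ z.1)
    (h1 : ∀ p ∈ y.1, AgreeAt w y p) (h2 : ∀ p ∈ z.1, p ∉ y.1 → AgreeAt w z p) :
    w = patch y z := by
  refine ext_of_agreeAt (by rw [h, patch_fst]) fun p hp => ?_
  by_cases hy : p ∈ y.1
  · exact (h1 p hy).trans (patch_left hy).symm
  · rw [h] at hp
    have hz := hp.resolve_left hy
    exact (h2 p hz hy).trans (patch_right hz hy).symm

end

end LocalSection

theorem isPatch_iff {x y : LocalSection F}
    {σ : ((TopCat.Sheaf.pullback (Type u) (patchMap X)).obj F).1.obj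
      (op (patchPreimage (x.1 ⊔ y.1)))} :
    IsPatch x y σ ↔ (⟨x.1 ⊔ y.1, σ⟩ : LocalSection ((patchMonad X).obj F)) =
      LocalSection.patch x.unit y.unit := by
  let Q := (TopCat.Sheaf.pullback (Type u) (patchMap X)).obj F
  let w : LocalSection ((patchMonad X).obj F) := ⟨x.1 ⊔ y.1, σ⟩
  have hx : patchPreimage x.1 ≤ patchPreimage (x.1 ⊔ y.1) := fun _ h => Or.inl h
  have hd : patchDiff y.1 x.1 ≤ patchPreimage (x.1 ⊔ y.1) := fun _ h => Or.inr h.1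
  have hd' : patchDiff y.1 x.1 ≤ patchPreimage y.1 := fun _ h => h.1
  constructor
  · rintro ⟨h1, h2⟩
    refine LocalSection.eq_patch (w := w) rfl (fun p hp => ⟨Or.inl hp, hp, ?_⟩)
      fun p hp hp' => ⟨Or.inr hp, hp, ?_⟩
    · have := congrArg (Q.presheaf.germ (patchPreimage x.1) (patchPoint X p) hp) h1
      exact (TopCat.Presheaf.germ_res_apply Q.presheaf (homOfLE hx) _ hp σ).symm.trans this
    · have := congrArg (Q.presheaf.germ (patchDiff y.1 x.1) (patchPoint X p) ⟨hp, hp'⟩) h2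
      refine (TopCat.Presheaf.germ_res_apply Q.presheaf (homOfLE hd) _ ⟨hp, hp'⟩ σ).symm.trans
        (this.trans ?_)
      exact TopCat.Presheaf.germ_res_apply Q.presheaf (homOfLE hd') (patchPoint X p) _ _
  · intro h
    constructor
    · refine TopCat.Presheaf.section_ext Q _ _ _ fun p hp => ?_
      refine (TopCat.Presheaf.germ_res_apply Q.presheaf (homOfLE hx) _ hp σ).trans ?_
      have : AgreeAt w x.unit p.ofTopology := by
        rw [show w = _ from h]
        exact LocalSection.patch_left hp
      exact this.2.2
    · refine TopCat.Presheaf.section_ext Q _ _ _ fun p hp => ?_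
      refine (TopCat.Presheaf.germ_res_apply Q.presheaf (homOfLE hd) _ hp σ).trans ?_
      refine Eq.trans ?_
        (TopCat.Presheaf.germ_res_apply Q.presheaf (homOfLE hd') _ hp (patchSection y)).symm
      have : AgreeAt w y.unit p.ofTopology := by
        rw [show w = _ from h]
        exact LocalSection.patch_right hp.1 hp.2
      exact this.2.2

theorem isPatchJoin_iff {a : (patchMonad X).obj F ⟶ F} {x y z : LocalSection F} :
    IsPatchJoin a x y z ↔ z = (LocalSection.patch x.unit y.unit).map a := by
  constructor
  · rintro ⟨σ, hσ, rfl⟩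
    rw [← isPatch_iff.1 hσ]
    rfl
  · rintro rfl
    have h : (LocalSection.patch x.unit y.unit).1 = x.1 ⊔ y.1 := LocalSection.patch_fst _ _
    -- The domain of the patch is `x.1 ⊔ y.1` only up to a proved equality; generalizing the patch
    -- to a variable `w` allows this equality to be substituted.
    have key : ∀ w : LocalSection ((patchMonad X).obj F), w = LocalSection.patch x.unit y.unit →
        w.1 = x.1 ⊔ y.1 → ∃ σ, IsPatch x y σ ∧
          w.map a = ⟨x.1 ⊔ y.1, a.1.app (op (x.1 ⊔ y.1).toOpens) σ⟩ := by
      rintro ⟨W, σ⟩ hw hW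
      obtain rfl : W = x.1 ⊔ y.1 := hW
      exact ⟨σ, isPatch_iff.2 hw, rfl⟩
    exact key _ rfl h
end

/-! ### From algebras to skew lattices -/

noncomputable section

variable {X : Type u} [TopologicalSpace X] [SpectralSpace X]
variable {F G : TopCat.Sheaf (Type u) (TopCat.of X)}

theorem compactOpens_inf_sup (U V W : CompactOpens X) : U ⊓ (V ⊔ W) = U ⊓ V ⊔ U ⊓ W :=
  SetLike.coe_injective (Set.inter_union_distrib_left _ _ _)

namespace LocalSection

section

variable {y z w : LocalSection ((patchMonad X).obj F)}

theorem patch_assoc (y z w : LocalSection ((patchMonad X).obj F)) :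
    patch (patch y z) w = patch y (patch z w) := by
  refine eq_patch (by simp only [patch_fst, sup_assoc]) (fun p hp => ?_) fun p hp hp' => ?_
  · exact (patch_left (mem_patch.2 (Or.inl hp))).trans (patch_left hp)
  · by_cases hz : p ∈ z.1
    · exact (patch_left (mem_patch.2 (Or.inr hz))).trans
        ((patch_right hz hp').trans (patch_left hz).symm)
    · have hw := (mem_patch.1 hp).resolve_left hz
      exact (patch_right hw fun h => (mem_patch.1 h).elim hp' hz).trans (patch_right hw hz).symm

theorem patch_of_le (h : z.1 ≤ y.1) : patch y z = y :=
  (eq_patch (sup_eq_left.2 h).symm (fun _ hp => AgreeAt.refl hp)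
    fun _ hp hp' => absurd (h hp) hp').symm

theorem patch_res_left (K : CompactOpens X) (z : LocalSection ((patchMonad X).obj F)) :
    patch (z.res K) z = z :=
  (eq_patch (y := z.res K) (sup_eq_right.2 inf_le_right).symm
    (fun _ hp => (AgreeAt.res z hp.1 hp.2).symm) fun _ hp _ => AgreeAt.refl hp).symm

theorem res_patch_left : (patch y z).res y.1 = y :=
  ext_of_agreeAt (by rw [res_fst, patch_fst, inf_eq_left.2 le_sup_left]) fun _ hp =>
    (AgreeAt.res _ hp.1 hp.2).trans (patch_left hp.1)

/-- Commuting local sections coincide on their common domain, so it does not matter which of them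
takes precedence there. -/
theorem patch_unit_comm {x y : LocalSection F} (h : x.meet y = y.meet x) :
    patch x.unit y.unit = patch y.unit x.unit := by
  have key : ∀ p ∈ x.1, p ∈ y.1 → AgreeAt x.unit y.unit p := fun p hx hy => by
    have h1 := AgreeAt.res x.unit (K := y.unit.1) hy hx
    have h2 := AgreeAt.res y.unit (K := x.unit.1) hx hy
    have e : x.unit.res y.unit.1 = y.unit.res x.unit.1 := by
      have := congrArg LocalSection.unit h
      rw [meet_eq_res, meet_eq_res, unit_res, unit_res] at this
      exact this.symm
    rw [e] at h1
    exact h1.symm.trans h2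
  refine eq_patch (by rw [patch_fst, sup_comm]) (fun p hp => ?_) fun p hp _ => patch_left hp
  by_cases hx : p ∈ x.1
  · exact (patch_left hx).trans (key p hx hp)
  · exact patch_right hp hx

end

section

variable (S : SkewLattice (LocalSection F)) (hS : ∀ x y, S.meet x y = x.meet y)
include hS

/-- The product `x ⋏ y ⋏ x` is the restriction of `x` to the intersection of the domains, so `𝒟`
remembers nothing but the domain. -/
theorem toReflection_le_iff_fst {x y : LocalSection F} :
    SkewLattice.toReflection x ≤ SkewLattice.toReflection y ↔ x.1 ≤ y.1 := by
  rw [SkewLattice.toReflection_le_iff_preceq]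
  change S.meet (S.meet x y) x = x ↔ _
  rw [hS, hS, meet_eq_res]
  constructor
  · intro h
    rw [← h]
    exact fun _ hp => hp.1.2
  · intro h
    exact res_eq_self x (le_inf le_rfl h)

theorem toReflection_eq_iff_fst {x y : LocalSection F} :
    SkewLattice.toReflection x = SkewLattice.toReflection y ↔ x.1 = y.1 := by
  rw [le_antisymm_iff, le_antisymm_iff, toReflection_le_iff_fst S hS, toReflection_le_iff_fst S hS]

/-- The lattice reflection of a skew lattice of local sections is the lattice of compact open
sets. -/
def reflectionIso (hF : IsGlobalSheaf X F) :
    SkewLattice.LatticeReflection (LocalSection F) ≃o CompactOpens X :=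
  RelIso.ofSurjective
    (OrderEmbedding.ofMapLEIff
      (Quotient.lift Sigma.fst fun x y h =>
        (toReflection_eq_iff_fst S hS).1 (Quotient.sound h) :
        SkewLattice.LatticeReflection (LocalSection F) → CompactOpens X)
      (by
        rintro ⟨x⟩ ⟨y⟩
        exact (toReflection_le_iff_fst S hS).symm))
    (fun K => by
      obtain ⟨x, hx⟩ := exists_res_eq hF K
      exact ⟨SkewLattice.toReflection x, hx⟩)

/-- All axioms except symmetry concern only restriction and the lattice of domains, so they hold for
every `⋎` that extends the band. -/
theorem isRightDistributive_of_symmetric (hF : IsGlobalSheaf X F)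
    (h : ∀ x y : LocalSection F, x ⋏ y = y ⋏ x ↔ x ⋎ y = y ⋎ x) :
    SkewLattice.IsRightDistributive (LocalSection F) where
  normal x y z := by
    simp only [hS, meet_eq_res, res_fst]
    rw [inf_right_comm]
  rightHanded x y := by
    simp only [hS, meet_eq_res]
    exact res_congr x (by change x.1 ⊓ y.1 ⊓ x.1 = _; rw [inf_right_comm, inf_idem, inf_comm])
  symmetric := h
  exists_zero := by
    obtain ⟨z, hz⟩ := exists_res_eq hF ⊥
    refine ⟨z, fun x => ⟨?_, ?_⟩⟩
    · rw [hS]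
      exact ext_of_bot (le_bot_iff.1 (inf_le_left.trans hz.le)) hz
    · rw [hS]
      exact ext_of_bot (le_bot_iff.1 (inf_le_right.trans hz.le)) hz
  reflection_bounded :=
    let e := reflectionIso S hS hF
    ⟨{ top := e.symm ⊤
       le_top := fun a => e.le_symm_apply.2 le_top
       bot := e.symm ⊥
       bot_le := fun a => e.symm_apply_le.2 bot_le }⟩
  reflection_distrib a b c := by
    apply (reflectionIso S hS hF).injective
    rw [map_inf, map_sup, map_sup, map_inf, map_inf]
    exact compactOpens_inf_sup _ _ _

end

end LocalSection

namespace PatchAlgebraStructure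

open LocalSection

variable (ξ : PatchAlgebraStructure F)

theorem unit_map (x : LocalSection F) : x.unit.map ξ.a = x := by
  rw [LocalSection.unit, ← map_comp, ξ.unit]
  rfl

/-- The operation `⋎` on local sections induced by an algebra structure. -/
def join (x y : LocalSection F) : LocalSection F := (patch x.unit y.unit).map ξ.a

/-- An algebra structure takes patches to joins. -/
theorem patch_map (y z : LocalSection ((patchMonad X).obj F)) :
    (patch y z).map ξ.a = ξ.join (y.map ξ.a) (z.map ξ.a) := by
  -- The patch is lifted to `T (T F)`. There `μ` carries the lift to `patch y z`, while `T ξ`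
  -- carries it to the patch of the values of `y` and `z`; associativity of `ξ` equates the two
  -- images in `F`.
  have h1 : (patch y.unit z.unit).map ((patchMonad X).μ.app F) = patch y z := by
    refine eq_patch (patch_fst (y.unit) (z.unit)) (fun p hp => ?_) fun p hp hp' => ?_
    · have := (patch_left (y := y.unit) (z := z.unit) hp).map_mu
      rwa [mu_unit] at this
    · have := (patch_right (y := y.unit) (z := z.unit) hp hp').map_mu
      rwa [mu_unit] at this
  have h2 : (patch y.unit z.unit).map ((patchMonad X).map ξ.a) =
      patch (y.map ξ.a).unit (z.map ξ.a).unit := by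
    refine eq_patch (patch_fst (y.unit) (z.unit)) (fun p hp => ?_) fun p hp hp' => ?_
    · have := (patch_left (y := y.unit) (z := z.unit) hp).map_map ξ.a
      rwa [unit_naturality] at this
    · have := (patch_right (y := y.unit) (z := z.unit) hp hp').map_map ξ.a
      rwa [unit_naturality] at this
  rw [← h1, join, ← h2, ← map_comp, ξ.assoc]
  rfl

/-- The skew lattice of local sections of an algebra. -/
@[reducible]
def skewLattice : SkewLattice (LocalSection F) where
  meet := LocalSection.meet
  join := ξ.join
  meet_assoc x y z := by
    simp only [meet_eq_res, res_res, res_fst]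
  join_assoc x y z := by
    -- Writing the outer factors as values of their units turns both sides into images of threefold
    -- patches in `T F`.
    conv_lhs => rw [← ξ.unit_map z]
    conv_rhs => rw [← ξ.unit_map x]
    rw [join.eq_def ξ x y, join.eq_def ξ y z, ← patch_map, ← patch_map, patch_assoc]
  meet_idem x := res_eq_self x le_rfl
  join_idem x := by rw [join, patch_of_le le_rfl, unit_map]
  meet_join_right x y := by rw [join, meet_eq_res, unit_res, patch_res_left, unit_map]
  meet_join_left x y := by
    rw [join, meet_eq_res, ← map_res]
    exact (congrArg (LocalSection.map ξ.a) (res_patch_left (y := x.unit))).trans (ξ.unit_map x)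
  join_meet_left x y := by
    rw [join, patch_of_le, unit_map]
    exact inf_le_left
  join_meet_right x y := by
    rw [join, meet_eq_res, res_eq_self]
    change x.1 ≤ (patch y.unit x.unit).1
    rw [patch_fst]
    exact le_sup_right

theorem isRightDistributive (hF : IsGlobalSheaf X F) :
    @SkewLattice.IsRightDistributive _ ξ.skewLattice := by
  let _ := ξ.skewLattice
  refine isRightDistributive_of_symmetric ξ.skewLattice (fun _ _ => rfl) hF fun x y => ⟨?_, ?_⟩
  · intro h
    change ξ.join x y = ξ.join y x
    rw [join, patch_unit_comm h]
    rfl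
  · intro h
    -- Both meets are restrictions of the common join to the intersection of the domains.
    calc x ⋏ y = x ⋏ (y ⋏ (y ⋎ x)) := by rw [SkewLattice.meet_join_left]
      _ = y ⋏ (x ⋏ (y ⋎ x)) := by
        change LocalSection.meet _ (LocalSection.meet _ _) =
          LocalSection.meet _ (LocalSection.meet _ _)
        simp only [meet_eq_res, res_res, inf_comm]
      _ = y ⋏ x := by rw [← h, SkewLattice.meet_join_left]

/-- The skew lattice structure on local sections corresponding to an algebra structure. -/
def toSkewExtension (hF : IsGlobalSheaf X F) : SkewExtension F :=
  ⟨ξ.skewLattice, fun _ _ => rfl, ξ.isRightDistributive hF⟩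

end PatchAlgebraStructure
end

/-! ### From skew lattices to algebras -/

noncomputable section

variable {X : Type u} [TopologicalSpace X] [SpectralSpace X]
variable {F G : TopCat.Sheaf (Type u) (TopCat.of X)}

theorem mem_compactOpens_inf {K L : CompactOpens X} {p : X} : p ∈ K ⊓ L ↔ p ∈ K ∧ p ∈ L := Iff.rfl

theorem mem_compactOpens_sup {K L : CompactOpens X} {p : X} : p ∈ K ⊔ L ↔ p ∈ K ∨ p ∈ L := Iff.rfl

namespace LocalSection

theorem mem_res {x : LocalSection F} {K : CompactOpens X} {p : X} :
    p ∈ (x.res K).1 ↔ p ∈ K ∧ p ∈ x.1 := Iff.rfl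

/-- Induction along a stratification of the domain of a local section of `T F` on whose strata it
comes from local sections of `F`. -/
theorem patch_section_induction (y : LocalSection ((patchMonad X).obj F))
    {P : CompactOpens X → Prop} (h0 : P ⊥)
    (hstep : ∀ (W : CompactOpens X) (x : LocalSection F), W ≤ y.1 → x.1 ≤ y.1 →
      (∀ p ∈ x.1, p ∉ W → AgreeAt y x.unit p) → P W → P (W ⊔ x.1)) : P y.1 := by
  refine patch_induction y.1 h0 fun p hp => ?_
  obtain ⟨x, D, hx, hD, hxy, h⟩ := exists_agreeAt_unit y hp
  refine ⟨x.1, D, hx, hD, fun W V hW hV hVx hVD hPW => ?_⟩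
  have := hstep W (x.res V) hW (inf_le_left.trans hV) (fun q hq hqW => ?_) hPW
  · rwa [res_fst, inf_eq_left.2 hVx] at this
  · rw [unit_res]
    exact (h q hq.2 fun hqD => hqW (hVD ⟨hq.1, hqD⟩)).trans
      (AgreeAt.res x.unit hq.1 hq.2).symm

section

variable [S : SkewLattice (LocalSection F)] (hS : ∀ x y : LocalSection F, x ⋏ y = x.meet y)
variable (hD : SkewLattice.IsRightDistributive (LocalSection F)) (hF : IsGlobalSheaf X F)

include hS hF in
theorem join_fst (x y : LocalSection F) : (x ⋎ y).1 = x.1 ⊔ y.1 :=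
  map_sup (reflectionIso S hS hF) (SkewLattice.toReflection x) (SkewLattice.toReflection y)

include hS hD in
theorem join_of_le {x y : LocalSection F} (h : y.1 ≤ x.1) : x ⋎ y = x :=
  hD.join_eq_left ((toReflection_le_iff_fst S hS).2 h)

include hS hF in
theorem res_join_self (x : LocalSection F) (K : CompactOpens X) : x.res K ⋎ x = x := by
  obtain ⟨k, rfl⟩ := exists_res_eq hF K
  rw [← meet_eq_res, ← hS, SkewLattice.meet_join_right]

include hS hD hF in
theorem join_res (x y : LocalSection F) (K : CompactOpens X) :
    (x ⋎ y).res K = x.res K ⋎ y.res K := by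
  obtain ⟨k, rfl⟩ := exists_res_eq hF K
  rw [← meet_eq_res, ← meet_eq_res, ← meet_eq_res, ← hS, ← hS, ← hS, hD.meet_join_distrib]

include hS hD hF in
-- Since `y = y.res K ⋎ y`, one can attach `y.res K` first; the result already has the full domain
-- and absorbs `y`.
theorem join_res_of_le {x y : LocalSection F} {K : CompactOpens X} (h : y.1 ≤ x.1 ⊔ K) :
    x ⋎ y.res K = x ⋎ y := by
  conv_rhs => rw [← res_join_self hS hF y K, ← SkewLattice.join_assoc]
  refine (join_of_le hS hD ?_).symm
  rw [join_fst hS hF]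
  exact fun p hp => (h hp).elim Or.inl fun hK => Or.inr ⟨hK, hp⟩

include hS hD hF in
/-- The join depends only on the germs of its second factor outside the domain of the first. -/
theorem join_congr_right {c x t : LocalSection F}
    (h : ∀ p, p ∉ c.1 → p ∈ x.1 ∨ p ∈ t.1 → AgreeAt x.unit t.unit p) : c ⋎ x = c ⋎ t := by
  -- Equality of germs in `φ^* F` gives agreement on neighbourhoods in `X`. The part of the domains
  -- outside `c` is compact in `X`, so a single compact open `K` around it works; what happens off
  -- `K` is hidden by `c`.
  have hc : IsCompact (((x.1 ⊔ t.1 : CompactOpens X) : Set X) \ c.1) :=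
    (x.1 ⊔ t.1).isCompact.diff c.1.isOpen
  obtain ⟨K, hK, hxt⟩ : ∃ K : CompactOpens X,
      ((x.1 ⊔ t.1 : CompactOpens X) : Set X) \ c.1 ⊆ K ∧ x.res K = t.res K := by
    refine hc.induction_on (p := fun s => ∃ K : CompactOpens X, s ⊆ K ∧ x.res K = t.res K)
      ⟨⊥, Set.empty_subset _, ext_of_bot (bot_inf_eq _) (bot_inf_eq _)⟩ ?_ ?_ ?_
    · rintro s s' hs ⟨K, hK, e⟩
      exact ⟨K, hs.trans hK, e⟩
    · rintro s s' ⟨K, hK, e⟩ ⟨K', hK', e'⟩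
      refine ⟨K ⊔ K', Set.union_subset (hK.trans fun _ => Or.inl) (hK'.trans fun _ => Or.inr), ?_⟩
      have hf := congrArg Sigma.fst e
      have hf' := congrArg Sigma.fst e'
      rw [res_fst, res_fst] at hf hf'
      refine ext_of_cover (K := K) (L := K') inf_le_left ?_ ?_ ?_
      · rw [res_fst, res_fst, inf_comm, compactOpens_inf_sup, inf_comm _ t.1, compactOpens_inf_sup,
          inf_comm, hf, inf_comm x.1, hf', inf_comm K, inf_comm K']
      · rw [res_res, res_res, inf_eq_left.2 le_sup_left, e]
      · rw [res_res, res_res, inf_eq_left.2 le_sup_right, e']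
    · rintro p ⟨hp, hpc⟩
      obtain ⟨K, hpK, e⟩ := exists_res_eq_of_agreeAt (h p hpc hp)
      exact ⟨K, mem_nhdsWithin_of_mem_nhds (K.isOpen.mem_nhds hpK), K, subset_rfl, e⟩
  rw [← join_res_of_le hS hD hF (K := K), hxt, join_res_of_le hS hD hF]
  · exact fun p hp => or_iff_not_imp_left.2 fun hpc => hK ⟨Or.inr hp, hpc⟩
  · exact fun p hp => or_iff_not_imp_left.2 fun hpc => hK ⟨Or.inl hp, hpc⟩

/-- `w` is the value at `y` of the morphism `T F ⟶ F` determined by the operation `⋎`. -/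
def IsValue (y : LocalSection ((patchMonad X).obj F)) (w : LocalSection F) : Prop :=
  w.1 = y.1 ∧ ∀ (K : CompactOpens X) (x : LocalSection F), x.1 ≤ y.1 →
    (∀ p ∈ x.1, p ∉ K → AgreeAt y x.unit p) → w.res (K ⊔ x.1) = w.res K ⋎ x

/-- Along a stratification of `y`, the recursion determines the value on each enlarged set from the
value on the previous one. -/
theorem IsValue.unique {y : LocalSection ((patchMonad X).obj F)} {w w' : LocalSection F}
    (h : IsValue y w) (h' : IsValue y w') : w = w' := by
  have : w.res y.1 = w'.res y.1 := by
    refine patch_section_induction y (P := fun K => w.res K = w'.res K)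
      (ext_of_bot (bot_inf_eq _) (bot_inf_eq _)) fun W x _ hx hxy hW => ?_
    rw [h.2 W x hx hxy, h'.2 W x hx hxy, hW]
  rwa [res_eq_self _ h.1.le, res_eq_self _ h'.1.le] at this

include hS hD hF in
theorem IsValue.res {y : LocalSection ((patchMonad X).obj F)} {w : LocalSection F}
    (h : IsValue y w) (K : CompactOpens X) : IsValue (y.res K) (w.res K) := by
  refine ⟨by rw [res_fst, res_fst, h.1], fun L x hx hxy => ?_⟩
  rw [res_res, inf_comm, ← res_res, h.2 L x (hx.trans inf_le_right), join_res hS hD hF, res_res,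
    res_res, inf_comm, res_eq_self x (hx.trans inf_le_left)]
  intro p hp hpL
  exact (AgreeAt.res y (hx hp).1 (hx hp).2).symm.trans (hxy p hp hpL)

include hS hD hF in
-- Inductive step of existence. For a test pair `K`, `x`, both sides of the recursion are brought to
-- the form `c ⋎ _` with the same `c = b ⋎ t.res K`, where `b` is the part of `w` over `K ⊔ x.1`.
-- The remaining factors `t.res (K ⊔ x.1)` and `x` need comparison only outside `c`, and there both
-- agree with `y`.
theorem IsValue.join {y : LocalSection ((patchMonad X).obj F)} {w t : LocalSection F}
    {W : CompactOpens X} (h : IsValue (y.res W) w) (hW : W ≤ y.1) (ht : t.1 ≤ y.1)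
    (hty : ∀ p ∈ t.1, p ∉ W → AgreeAt y t.unit p) : IsValue (y.res (W ⊔ t.1)) (w ⋎ t) := by
  have hw : w.1 = W := h.1.trans (inf_eq_left.2 hW)
  have hWt : W ⊔ t.1 ≤ y.1 := sup_le hW ht
  refine ⟨by rw [join_fst hS hF, hw, res_fst, inf_eq_left.2 hWt], fun K x hx hxy => ?_⟩
  rw [res_fst, inf_eq_left.2 hWt] at hx
  have hxy' : ∀ p ∈ x.1, p ∉ K → AgreeAt y x.unit p := fun p hp hpK =>
    (AgreeAt.res y (hx hp) (hWt (hx hp))).symm.trans (hxy p hp hpK)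
  set b := w.res (K ⊔ x.1) with hb
  -- The recursion for `w` is applied to the part of `x` inside `W`.
  have hb' : b = w.res K ⋎ x.res W := by
    rw [← h.2 K (x.res W), hb]
    · refine res_congr w (SetLike.ext fun p => ?_)
      simp only [mem_compactOpens_inf, mem_compactOpens_sup, res_fst, hw]
      tauto
    · rw [res_fst, res_fst, inf_eq_left.2 hW]
      exact inf_le_left
    · intro p hp hpK
      rw [unit_res]
      exact (AgreeAt.res y hp.1 (hW hp.1)).trans
        ((hxy' p hp.2 hpK).trans (AgreeAt.res x.unit hp.1 hp.2).symm)
  have e1 : (w.res K ⋎ t.res K ⋎ x).res W = b := by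
    rw [join_res hS hD hF, join_res hS hD hF, hb', res_res w, res_res t,
      join_of_le hS hD (x := w.res (W ⊓ K))]
    · congr 1
      refine res_congr w (SetLike.ext fun p => ?_)
      simp only [mem_compactOpens_inf, hw]
      tauto
    · intro p hp
      exact ⟨hp.1, hw ▸ hp.1.1⟩
  -- By `e1` the left side restricts to `b` over `W`, so `b` may be joined in front, where it
  -- absorbs `w.res K`.
  have e2 : w.res K ⋎ t.res K ⋎ x = b ⋎ t.res K ⋎ x := by
    rw [← res_join_self hS hF (w.res K ⋎ t.res K ⋎ x) W, e1, ← SkewLattice.join_assoc,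
      ← SkewLattice.join_assoc, join_of_le hS hD (x := b) (y := w.res K)]
    exact inf_le_inf_right _ le_sup_left
  have e3 : (w ⋎ t).res (K ⊔ x.1) = b ⋎ t.res K ⋎ t.res (K ⊔ x.1) := by
    rw [join_res hS hD hF, SkewLattice.join_assoc]
    congr 1
    have := res_join_self hS hF (t.res (K ⊔ x.1)) K
    rw [res_res, inf_eq_left.2 le_sup_left] at this
    exact this.symm
  rw [e3, join_res hS hD hF, e2]
  refine join_congr_right hS hD hF fun p hpc hp => ?_
  have hpb : ¬ (p ∈ K ⊔ x.1 ∧ p ∈ w.1) := fun hh => hpc (by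
    rw [join_fst hS hF]
    exact Or.inl hh)
  have hpt : ¬ (p ∈ K ∧ p ∈ t.1) := fun hh => hpc (by
    rw [join_fst hS hF]
    exact Or.inr hh)
  rw [hw, mem_compactOpens_sup] at hpb
  simp only [mem_res, mem_compactOpens_sup] at hp
  have hx' : p ∈ x.1 → p ∈ W ∨ p ∈ t.1 := fun hh => hx hh
  have h1 : p ∈ x.1 := by tauto
  have h2 : p ∈ t.1 := by tauto
  have h3 : p ∉ W := by tauto
  have h4 : p ∉ K := by tauto
  rw [unit_res]
  exact ((AgreeAt.res t.unit (Or.inr h1) h2).trans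
    ((hty p h2 h3).symm.trans (hxy' p h1 h4)))

include hS hD hF in
theorem exists_isValue (y : LocalSection ((patchMonad X).obj F)) : ∃ w, IsValue y w := by
  have : ∃ w, IsValue (y.res y.1) w := by
    refine patch_section_induction y (P := fun K => ∃ w, IsValue (y.res K) w) ?_ ?_
    · obtain ⟨w, hw⟩ := exists_res_eq hF ⊥
      refine ⟨w, hw.trans (bot_inf_eq _).symm, fun K x hx _ => ?_⟩
      rw [res_fst, bot_inf_eq, le_bot_iff] at hx
      rw [join_of_le hS hD (hx.trans_le bot_le), hx, sup_bot_eq]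
    · rintro W x hW hx hxy ⟨w, hw⟩
      exact ⟨_, hw.join hS hD hF hW hx hxy⟩
  rwa [res_eq_self _ le_rfl] at this

include hS hD hF in
theorem isValue_unit (x : LocalSection F) : IsValue x.unit x := by
  refine ⟨rfl, fun K t ht htx => ?_⟩
  have e : x.res (K ⊔ t.1) = x.res K ⋎ x.res (K ⊔ t.1) := by
    have := res_join_self hS hF (x.res (K ⊔ t.1)) K
    rw [res_res, inf_eq_left.2 le_sup_left] at this
    exact this.symm
  rw [e]
  refine join_congr_right hS hD hF fun p hpc hp => ?_
  have hpK : ¬ (p ∈ K ∧ p ∈ x.1) := hpc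
  simp only [mem_res, mem_compactOpens_sup] at hp
  have htx' : p ∈ t.1 → p ∈ x.1 := fun hh => ht hh
  have h1 : p ∈ t.1 := by tauto
  have h2 : p ∉ K := by tauto
  rw [unit_res]
  exact (AgreeAt.res x.unit (Or.inr h1) (ht h1)).trans (htx p h1 h2)

/-- Values are computed by joins also along local sections of `T F`. -/
theorem IsValue.res_sup {y z : LocalSection ((patchMonad X).obj F)} {w v : LocalSection F}
    (hS : ∀ x y : LocalSection F, x ⋏ y = x.meet y)
    (hD : SkewLattice.IsRightDistributive (LocalSection F))
    (hw : IsValue y w) (hv : IsValue z v) (K : CompactOpens X) (hzy : z.1 ≤ y.1)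
    (h : ∀ p ∈ z.1, p ∉ K → AgreeAt y z p) : w.res (K ⊔ z.1) = w.res K ⋎ v := by
  have : w.res (K ⊔ z.1) = w.res K ⋎ v.res z.1 := by
    refine patch_section_induction z
      (P := fun V => w.res (K ⊔ V) = w.res K ⋎ v.res V) ?_ ?_
    · rw [sup_bot_eq, join_of_le hS hD]
      exact inf_le_left.trans bot_le
    · intro W x hW hx hxz e
      rw [hv.2 W x hx hxz, ← SkewLattice.join_assoc, ← e, ← sup_assoc,
        hw.2 (K ⊔ W) x (hx.trans hzy)]
      intro p hp hpK
      exact (h p (hx hp) fun hh => hpK (Or.inl hh)).trans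
        (hxz p hp fun hh => hpK (Or.inr hh))
  rwa [res_eq_self v hv.1.le] at this

include hS hD hF in
/-- The algebra structure determined by a skew lattice structure. -/
theorem exists_patchAlgebraStructure :
    ∃ ξ : PatchAlgebraStructure F, ∀ y, IsValue y (y.map ξ.a) := by
  choose f hf using exists_isValue hS hD hF
  -- Uniqueness of values makes the choice `f` compatible with restriction.
  obtain ⟨a, ha⟩ := exists_hom f (fun y => (hf y).1) fun y K =>
    (hf _).unique ((hf y).res hS hD hF K)
  have hu : ∀ x : LocalSection F, x.unit.map a = x := fun x => by
    rw [ha]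
    exact (hf _).unique (isValue_unit hS hD hF x)
  refine ⟨⟨a, hom_ext fun x => ?_, hom_ext fun y => ?_⟩, fun y => ?_⟩
  · rw [map_comp, hu]
    rfl
  · rw [map_comp, map_comp, ha, ha]
    set w := f (y.map ((patchMonad X).μ.app F)) with hw
    set v := f (y.map ((patchMonad X).map a)) with hv
    -- On a stratum where `y` comes from a section `t` of `T F`, the section `μ y` agrees with `t`
    -- and `(T a) y` agrees with the unit of `a t`; both recursions therefore attach the same `a t`.
    have : w.res y.1 = v.res y.1 := by
      refine patch_section_induction (F := (patchMonad X).obj F) y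
        (P := fun K => w.res K = v.res K) (ext_of_bot (bot_inf_eq _) (bot_inf_eq _)) ?_
      intro W t _ ht hty e
      rw [(hf (y.map ((patchMonad X).μ.app F))).res_sup hS hD (hf t) W ht, ← hw, e, ← ha t]
      · refine ((hf (y.map ((patchMonad X).map a))).2 W (t.map a) ht fun p hp hpW => ?_).symm
        rw [← unit_naturality]
        exact (hty p hp hpW).map_map a
      · intro p hp hpW
        have := (hty p hp hpW).map_mu
        rwa [mu_unit] at this
    exact (res_eq_self w (hf _).1.le).symm.trans (this.trans (res_eq_self v (hf _).1.le))
  · change IsValue y (y.map a)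
    rw [ha]
    exact hf y

end

end LocalSection
end

/-! ### The bijection for a fixed sheaf -/

noncomputable section

variable {X : Type u} [TopologicalSpace X] [SpectralSpace X]
variable {F G : TopCat.Sheaf (Type u) (TopCat.of X)}

theorem SkewLattice.ext_of_ops {S : Type u} {A B : SkewLattice S}
    (h1 : ∀ x y, A.meet x y = B.meet x y) (h2 : ∀ x y, A.join x y = B.join x y) : A = B := by
  obtain ⟨m, j⟩ := A
  obtain ⟨m', j'⟩ := B
  obtain rfl : m = m' := funext fun x => funext (h1 x)
  obtain rfl : j = j' := funext fun x => funext (h2 x)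
  rfl

namespace PatchAlgebraStructure

open LocalSection

theorem ext_of_map {ξ ξ' : PatchAlgebraStructure F}
    (h : ∀ y : LocalSection ((patchMonad X).obj F), y.map ξ.a = y.map ξ'.a) :
    ξ = ξ' := by
  obtain ⟨a, _, _⟩ := ξ
  obtain ⟨a', _, _⟩ := ξ'
  obtain rfl : a = a' := hom_ext h
  rfl

/-- An algebra structure is recovered from the induced operation `⋎`. -/
theorem isValue_map (ξ : PatchAlgebraStructure F) (y : LocalSection ((patchMonad X).obj F)) :
    IsValue (S := ξ.skewLattice) y (y.map ξ.a) := by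
  refine ⟨rfl, fun K x hx h => ?_⟩
  have e : y.res (K ⊔ x.1) = patch (y.res K) x.unit := by
    refine eq_patch (SetLike.ext fun p => ?_) (fun p hp => ?_) fun p hp hpK => ?_
    · have : p ∈ x.1 → p ∈ y.1 := fun hh => hx hh
      simp only [mem_res, mem_compactOpens_sup, map_fst]
      tauto
    · exact (AgreeAt.res y (Or.inl hp.1) hp.2).trans (AgreeAt.res y hp.1 hp.2).symm
    · have hpy : p ∈ y.1 := hx hp
      exact (AgreeAt.res y (Or.inr hp) hpy).trans (h p hp fun hh => hpK ⟨hh, hpy⟩)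
  change _ = ξ.join _ x
  rw [← map_res, e, patch_map, map_res, unit_map]

/-- Injectivity is uniqueness of values. For surjectivity, the algebra built from `⋎` induces `⋎`
again, because `x ⋎ y` is a value at the patch of `x` and `y` by one application of `IsValue.join`.
-/
theorem toSkewExtension_bijective (hF : IsGlobalSheaf X F) :
    Function.Bijective fun ξ : PatchAlgebraStructure F => ξ.toSkewExtension hF := by
  constructor
  · intro ξ ξ' h
    have h' : ξ.skewLattice = ξ'.skewLattice := congrArg Subtype.val h
    refine ext_of_map fun y => ?_
    have := ξ.isValue_map y
    rw [h'] at this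
    exact IsValue.unique (S := ξ'.skewLattice) this (ξ'.isValue_map y)
  · rintro ⟨S, hS, hD⟩
    obtain ⟨ξ, hξ⟩ := exists_patchAlgebraStructure hS hD hF
    refine ⟨ξ, Subtype.ext (SkewLattice.ext_of_ops (fun x y => (hS x y).symm) fun x y => ?_)⟩
    refine (hξ (patch x.unit y.unit)).unique ?_
    have h := IsValue.join hS hD hF (y := patch x.unit y.unit) (w := x) (t := y) (W := x.1)
      (by
        have e : (patch x.unit y.unit).res x.1 = x.unit := res_patch_left
        rw [e]
        exact isValue_unit hS hD hF x)
      (by rw [patch_fst]; exact le_sup_left) (by rw [patch_fst]; exact le_sup_right)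
      (fun p hp hp' => patch_right hp hp')
    have e : (patch x.unit y.unit).res (x.1 ⊔ y.1) = patch x.unit y.unit :=
      res_eq_self _ (patch_fst x.unit y.unit).le
    rwa [e] at h

end PatchAlgebraStructure

/-- Algebra structures correspond to skew lattice structures. -/
def patchAlgebraStructureEquiv (hF : IsGlobalSheaf X F) :
    PatchAlgebraStructure F ≃ SkewExtension F :=
  Equiv.ofBijective _ (PatchAlgebraStructure.toSkewExtension_bijective hF)

theorem LocalSection.patch_map_map (f : F ⟶ G) (y z : LocalSection ((patchMonad X).obj F)) :
    (LocalSection.patch y z).map ((patchMonad X).map f) =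
      LocalSection.patch (y.map ((patchMonad X).map f)) (z.map ((patchMonad X).map f)) :=
  eq_patch (patch_fst y z) (fun _ hp => (patch_left (y := y) (z := z) hp).map_map f)
    fun _ hp hp' => (patch_right (y := y) (z := z) hp hp').map_map f

/-! ### The functor to skew lattices and its full faithfulness -/

section Functor

open LocalSection

variable (A B : GlobalPatchAlgebra X)

/-- The algebra structure on the underlying sheaf of an algebra. -/
def GlobalPatchAlgebra.str : PatchAlgebraStructure A.obj.A := ⟨A.obj.a, A.obj.unit, A.obj.assoc⟩

variable {A B}

theorem GlobalPatchAlgebra.map_join (f : A.obj ⟶ B.obj) (x y : LocalSection A.obj.A) :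
    ((str A).join x y).map f.f = (str B).join (x.map f.f) (y.map f.f) := by
  change (((LocalSection.patch x.unit y.unit).map A.obj.a).map f.f) = _
  rw [← LocalSection.map_comp, ← f.h, LocalSection.map_comp, patch_map_map, unit_naturality,
    unit_naturality]
  rfl

variable (X) in
/-- The skew lattice over the lattice of compact open sets of a global algebra. -/
def skewLatticeFunctor :
    GlobalPatchAlgebra X ⥤ RightDistributiveSkewLatticeOver (CompactOpens X) where
  obj A :=
    { carrier := LocalSection A.obj.A
      skewLattice := (GlobalPatchAlgebra.str A).skewLattice
      isRightDistributive := (GlobalPatchAlgebra.str A).isRightDistributive A.property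
      reflectionIso := LocalSection.reflectionIso (GlobalPatchAlgebra.str A).skewLattice
        (fun _ _ => rfl) A.property }
  map {A B} f :=
    { toFun := LocalSection.map f.hom.f
      map_meet := fun x y => by
        change LocalSection.map f.hom.f (x.meet y) = LocalSection.meet _ _
        rw [meet_eq_res, map_res]
        rfl
      map_join := fun x y => GlobalPatchAlgebra.map_join f.hom x y
      proj_comp := fun x => rfl }
  map_id A := rfl
  map_comp f g := rfl

instance : (skewLatticeFunctor X).Faithful where
  map_injective {A B} f g h := by
    apply ObjectProperty.hom_ext
    refine Monad.Algebra.Hom.ext (hom_ext fun x => ?_)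
    exact congrFun (congrArg RightDistributiveSkewLatticeOver.Hom.toFun h) x

instance : (skewLatticeFunctor X).Full where
  map_surjective {A B} g := by
    have h1 : ∀ x : LocalSection A.obj.A, Sigma.fst (g.toFun x : LocalSection B.obj.A) = x.1 :=
      g.proj_comp
    have hm : ∀ x y : LocalSection A.obj.A,
        g.toFun (x.meet y) = LocalSection.meet (F := B.obj.A) (g.toFun x) (g.toFun y) := g.map_meet
    have hj : ∀ x y : LocalSection A.obj.A, g.toFun ((GlobalPatchAlgebra.str A).join x y) =
        (GlobalPatchAlgebra.str B).join (g.toFun x) (g.toFun y) := g.map_join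
    obtain ⟨f, hf⟩ := exists_hom (F := A.obj.A) (G := B.obj.A) g.toFun h1 fun x K => by
      obtain ⟨k, rfl⟩ := exists_res_eq A.property K
      rw [← meet_eq_res, hm]
      exact congrArg (LocalSection.res (F := B.obj.A) (g.toFun x)) (h1 k)
    refine ⟨ObjectProperty.homMk ⟨f, hom_ext fun y => ?_⟩, ?_⟩
    · rw [LocalSection.map_comp, LocalSection.map_comp]
      have hA := (GlobalPatchAlgebra.str A).isValue_map y
      have hB := (GlobalPatchAlgebra.str B).isValue_map (y.map ((patchMonad X).map f))
      -- Compatibility with the structure maps is checked along strata of `y`: on each one, both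
      -- composites attach the image of the same section `x`, since `g` preserves joins.
      have := patch_section_induction y
        (P := fun K => ((y.map ((patchMonad X).map f)).map B.obj.a).res K =
          ((y.map A.obj.a).map f).res K) (ext_of_bot (bot_inf_eq _) (bot_inf_eq _)) ?_
      · exact (res_eq_self (F := B.obj.A) ((y.map ((patchMonad X).map f)).map B.obj.a)
          le_rfl).symm.trans (this.trans (res_eq_self (F := B.obj.A) _ le_rfl))
      · intro W x hW hx hxy e
        refine (hB.2 W (x.map f) hx fun p hp hpW => ?_).trans ?_
        · rw [← unit_naturality]
          exact (hxy p hp hpW).map_map f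
        · refine Eq.trans ?_ (map_res f (y.map A.obj.a) (W ⊔ x.1))
          have e1 := congrArg (LocalSection.map f) (hA.2 W x hx hxy)
          refine Eq.trans ?_ e1.symm
          rw [hf, hf]
          refine Eq.trans ?_ (hj _ _).symm
          refine congrArg (fun z => (GlobalPatchAlgebra.str B).join z (g.toFun x)) ?_
          refine e.trans ?_
          rw [← map_res, hf]
          rfl
    · refine RightDistributiveSkewLatticeOver.Hom.ext (funext fun x => ?_)
      exact hf x

end Functor
end

/-! ### The sheaf of a skew lattice, and essential surjectivity -/

noncomputable section

namespace RightDistributiveSkewLatticeOver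

section

variable {L : Type u} [Lattice L] (S : RightDistributiveSkewLatticeOver L) {x y k : S.carrier}

theorem proj_meet (x y : S.carrier) : S.proj (x ⋏ y) = S.proj x ⊓ S.proj y := by
  rw [proj, SkewLattice.toReflection_meet, map_inf]
  rfl

theorem proj_join (x y : S.carrier) : S.proj (x ⋎ y) = S.proj x ⊔ S.proj y := by
  rw [proj, SkewLattice.toReflection_join, map_sup]
  rfl

theorem exists_proj_eq (K : L) : ∃ x : S.carrier, S.proj x = K := by
  obtain ⟨a, ha⟩ := S.reflectionIso.surjective K
  obtain ⟨x, rfl⟩ := Quotient.exists_rep a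
  exact ⟨x, ha⟩

variable {S}

theorem meet_of_proj_le (h : S.proj x ≤ S.proj y) : y ⋏ x = x :=
  S.isRightDistributive.meet_eq_right (S.reflectionIso.le_iff_le.1 h)

theorem meet_congr_of_proj (h : S.proj x = S.proj y) (k : S.carrier) : x ⋏ k = y ⋏ k :=
  S.isRightDistributive.meet_congr_left (S.reflectionIso.injective h) k

theorem ext_of_proj_le {w w' : S.carrier} (h1 : x ⋏ w = x ⋏ w') (h2 : y ⋏ w = y ⋏ w')
    (hw : S.proj w ≤ S.proj x ⊔ S.proj y) (hw' : S.proj w' ≤ S.proj x ⊔ S.proj y) : w = w' := by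
  rw [← proj_join] at hw hw'
  exact S.isRightDistributive.ext_of_meet h1 h2 (S.reflectionIso.le_iff_le.1 hw)
    (S.reflectionIso.le_iff_le.1 hw')

/-- If `k` is a restriction of `y`, then restricting `y` to the domain of `k` gives `k`. -/
theorem meet_eq_of_proj_eq {z : S.carrier} (h : k ⋏ y = k) (hz : S.proj (z ⋏ y) = S.proj k) :
    z ⋏ y = k := by
  rw [← h, ← meet_congr_of_proj hz, SkewLattice.meet_assoc, SkewLattice.meet_idem]

end

section Sheaf

variable {X : Type u} [TopologicalSpace X] [SpectralSpace X]
variable (S : RightDistributiveSkewLatticeOver (CompactOpens X))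

theorem exists_bot : ∃ z : S.carrier, S.proj z = ⊥ ∧ ∀ x, S.proj x = ⊥ → x = z := by
  obtain ⟨z, hz⟩ := S.isRightDistributive.exists_zero
  have hz' : S.proj z = ⊥ := by
    obtain ⟨y, hy⟩ := S.exists_proj_eq ⊥
    have := congrArg S.proj (hz y).1
    rw [proj_meet, hy] at this
    exact le_bot_iff.1 (this.symm.le.trans inf_le_right)
  refine ⟨z, hz', fun x hx => ?_⟩
  rw [← meet_of_proj_le (S := S) (x := x) (y := z) (hx.trans_le bot_le), (hz x).1]

/-- Sections over an open set of the sheaf associated with a skew lattice: compatible families of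
elements over the compact open subsets. -/
def Sections (U : Opens X) : Type u :=
  {f : {K : CompactOpens X // K.toOpens ≤ U} → S.carrier //
    (∀ K, S.proj (f K) = K.1) ∧ ∀ K K', K.1 ≤ K'.1 → f K ⋏ f K' = f K}

/-- The presheaf associated with a skew lattice. -/
def presheaf : TopCat.Presheaf (Type u) (TopCat.of X) where
  obj U := S.Sections U.unop
  map {U V} i := TypeCat.ofHom fun f =>
    ⟨fun K => f.1 ⟨K.1, K.2.trans (leOfHom i.unop)⟩, fun K => f.2.1 _, fun K K' h => f.2.2 _ _ h⟩

variable {S}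

section Glue

variable {ι : Type u} {U : ι → Opens X} (f : ∀ i, S.Sections (U i))

/-- `x` is an element over `Z` that restricts to the family `f`. -/
def IsGlue (Z : CompactOpens X) (x : S.carrier) : Prop :=
  S.proj x = Z ∧ ∀ i (K : CompactOpens X) (hK : K.toOpens ≤ U i), K ≤ Z →
    (f i).1 ⟨K, hK⟩ ⋏ x = (f i).1 ⟨K, hK⟩

variable {f}

theorem exists_nhd_le {Z : CompactOpens X} (hZ : Z.toOpens ≤ iSup U) {p : X} (hp : p ∈ Z) :
    ∃ (i : ι) (C : CompactOpens X), p ∈ C ∧ C.toOpens ≤ U i := by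
  obtain ⟨i, hi⟩ := Opens.mem_iSup.1 (hZ hp)
  obtain ⟨C, hC, hCU⟩ := LocalSection.exists_compactOpens hi
  exact ⟨i, C, hC, hCU⟩

theorem IsGlue.unique {Z : CompactOpens X} (hZ : Z.toOpens ≤ iSup U) {x y : S.carrier}
    (hx : IsGlue f Z x) (hy : IsGlue f Z y) : x = y := by
  have : ∀ k, S.proj k = Z → k ⋏ x = k ⋏ y := by
    refine patch_induction (P := fun K => ∀ k, S.proj k = K → k ⋏ x = k ⋏ y) Z ?_ fun p hp => ?_
    · intro k hk
      obtain ⟨z, -, hz⟩ := S.exists_bot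
      rw [hz (k ⋏ x), hz (k ⋏ y)]
      · rw [proj_meet, hk, bot_inf_eq]
      · rw [proj_meet, hk, bot_inf_eq]
    · obtain ⟨i, C, hC, hCU⟩ := exists_nhd_le hZ hp
      -- Taking `D = ⊥` reduces the stratification to an ordinary open cover of `Z` by compact
      -- opens, each inside some `U i`.
      refine ⟨C, ⊥, hC, fun h => h, fun W V _ hVZ hVC _ hP k hk => ?_⟩
      have hVU : V.toOpens ≤ U i := le_trans (show V.toOpens ≤ C.toOpens from hVC) hCU
      obtain ⟨w, hw⟩ := S.exists_proj_eq W
      have hk' : ∀ a, S.proj (k ⋏ a) ≤ S.proj w ⊔ S.proj ((f i).1 ⟨V, hVU⟩) := fun a => by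
        rw [proj_meet, hk, hw, (f i).2.1]
        exact inf_le_left
      refine ext_of_proj_le (x := w) (y := (f i).1 ⟨V, hVU⟩) ?_ ?_ (hk' x) (hk' y)
      · rw [S.isRightDistributive.meet_left_comm w, hP w hw, S.isRightDistributive.meet_left_comm w]
      · rw [S.isRightDistributive.meet_left_comm _ k, hx.2 i V hVU hVZ,
          S.isRightDistributive.meet_left_comm _ k, hy.2 i V hVU hVZ]
  have h := this x hx.1
  rwa [SkewLattice.meet_idem, meet_of_proj_le (hy.1.trans hx.1.symm).le] at h

/-- The glued element grows by one compact open at a time. The element `x` over `W` and the new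
piece `y` over `V` commute, since both meets are the given section over `W ⊓ V`; hence `x ⋎ y`
restricts to both. -/
theorem exists_isGlue (hf : ∀ i j (K : CompactOpens X) (hi : K.toOpens ≤ U i)
    (hj : K.toOpens ≤ U j), (f i).1 ⟨K, hi⟩ = (f j).1 ⟨K, hj⟩)
    {Z : CompactOpens X} (hZ : Z.toOpens ≤ iSup U) : ∃ x, IsGlue f Z x := by
  refine patch_induction (P := fun K => ∃ x, IsGlue f K x) Z ?_ fun p hp => ?_
  · obtain ⟨z, hz, hz'⟩ := S.exists_bot
    refine ⟨z, hz, fun i K hK hK' => ?_⟩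
    rw [hz' ((f i).1 ⟨K, hK⟩) (((f i).2.1 _).trans (le_bot_iff.1 hK')), SkewLattice.meet_idem]
  · obtain ⟨i, C, hC, hCU⟩ := exists_nhd_le hZ hp
    refine ⟨C, ⊥, hC, fun h => h, fun W V _ hVZ hVC _ => ?_⟩
    rintro ⟨x, hx⟩
    have hVU : V.toOpens ≤ U i := le_trans (show V.toOpens ≤ C.toOpens from hVC) hCU
    set y := (f i).1 ⟨V, hVU⟩ with hy
    have hyV : S.proj y = V := (f i).2.1 _
    have hWU : (W ⊓ V).toOpens ≤ U i :=
      le_trans (show (W ⊓ V).toOpens ≤ V.toOpens from fun _ h => h.2) hVU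
    have hxy : x ⋏ y = y ⋏ x := by
      have e1 : x ⋏ y = (f i).1 ⟨W ⊓ V, hWU⟩ := by
        refine meet_eq_of_proj_eq ((f i).2.2 _ _ inf_le_right) ?_
        rw [proj_meet, hx.1, hyV, (f i).2.1]
      have e2 : y ⋏ x = (f i).1 ⟨W ⊓ V, hWU⟩ := by
        refine meet_eq_of_proj_eq (hx.2 i _ hWU inf_le_left) ?_
        rw [proj_meet, hx.1, hyV, (f i).2.1, inf_comm]
      rw [e1, e2]
    refine ⟨x ⋎ y, by rw [proj_join, hx.1, hyV], fun j K hK hKW => ?_⟩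
    have hpk : S.proj ((f j).1 ⟨K, hK⟩) = K := (f j).2.1 _
    have hKx : (K ⊓ W).toOpens ≤ U j :=
      le_trans (show (K ⊓ W).toOpens ≤ K.toOpens from fun _ h => h.1) hK
    have hKy : (K ⊓ V).toOpens ≤ U j :=
      le_trans (show (K ⊓ V).toOpens ≤ K.toOpens from fun _ h => h.1) hK
    -- That `x ⋎ y` restricts to `f j` over `K` is tested over `x` and over `y` separately; the test
    -- over `y` uses the agreement of `f i` and `f j`.
    refine ext_of_proj_le (x := x) (y := y) ?_ ?_ ?_ ?_
    · rw [S.isRightDistributive.meet_left_comm, SkewLattice.meet_join_left]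
      have e1 : (f j).1 ⟨K, hK⟩ ⋏ x = (f j).1 ⟨K ⊓ W, hKx⟩ := by
        refine meet_eq_of_proj_eq (hx.2 j _ hKx inf_le_right) ?_
        rw [proj_meet, hpk, hx.1, (f j).2.1]
      have e2 : x ⋏ (f j).1 ⟨K, hK⟩ = (f j).1 ⟨K ⊓ W, hKx⟩ := by
        refine meet_eq_of_proj_eq ((f j).2.2 _ _ inf_le_left) ?_
        rw [proj_meet, hpk, hx.1, (f j).2.1, inf_comm]
      rw [e1, e2]
    · rw [S.isRightDistributive.meet_left_comm, S.isRightDistributive.meet_join_of_comm hxy]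
      have hKi : (K ⊓ V).toOpens ≤ U i :=
        le_trans (show (K ⊓ V).toOpens ≤ V.toOpens from fun _ h => h.2) hVU
      have e1 : (f j).1 ⟨K, hK⟩ ⋏ y = (f j).1 ⟨K ⊓ V, hKy⟩ := by
        rw [hf j i _ hKy hKi]
        refine meet_eq_of_proj_eq ((f i).2.2 _ _ inf_le_right) ?_
        rw [proj_meet, hpk, hyV, (f i).2.1]
      have e2 : y ⋏ (f j).1 ⟨K, hK⟩ = (f j).1 ⟨K ⊓ V, hKy⟩ := by
        refine meet_eq_of_proj_eq ((f j).2.2 _ _ inf_le_left) ?_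
        rw [proj_meet, hpk, hyV, (f j).2.1, inf_comm]
      rw [e1, e2]
    · rw [proj_meet, proj_join]
      exact inf_le_right
    · rw [hpk, hx.1, hyV]
      exact hKW

end Glue

variable (S)

theorem presheaf_isSheaf : S.presheaf.IsSheaf := by
  refine TopCat.Presheaf.isSheaf_of_isSheafUniqueGluing_types _ fun ι U f hf => ?_
  have hf' : ∀ i j (K : CompactOpens X) (hi : K.toOpens ≤ U i)
      (hj : K.toOpens ≤ U j), (f i).1 ⟨K, hi⟩ = (f j).1 ⟨K, hj⟩ := by
    intro i j K hi hj
    have := congrArg (fun s : S.Sections (U i ⊓ U j) => s.1 ⟨K, le_inf hi hj⟩) (hf i j)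
    exact this
  choose g hg using fun (Z : {Z : CompactOpens X // Z.toOpens ≤ iSup U}) =>
    exists_isGlue (S := S) hf' Z.2
  refine ⟨⟨g, fun Z => (hg Z).1, fun Z Z' h => ?_⟩, fun i => ?_, fun g' hg' => ?_⟩
  · refine IsGlue.unique (f := f) Z.2 ⟨?_, fun i K hK hKZ => ?_⟩ (hg Z)
    · rw [proj_meet, (hg Z).1, (hg Z').1, inf_eq_left.2 h]
    · rw [← SkewLattice.meet_assoc, (hg Z).2 i K hK hKZ, (hg Z').2 i K hK (hKZ.trans h)]
  · refine Subtype.ext (funext fun K => ?_)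
    refine IsGlue.unique (f := f) (Z := K.1) (K.2.trans (le_iSup U i)) (hg _)
      ⟨(f i).2.1 K, fun j K' hK' hKK' => ?_⟩
    have hi : K'.toOpens ≤ U i := le_trans (show K'.toOpens ≤ K.1.toOpens from hKK') K.2
    rw [hf' j i K' hK' hi]
    exact (f i).2.2 ⟨K', hi⟩ K hKK'
  · refine Subtype.ext (funext fun Z => ?_)
    refine IsGlue.unique (f := f) Z.2 ⟨g'.2.1 Z, fun i K hK hKZ => ?_⟩ (hg Z)
    have : (f i).1 ⟨K, hK⟩ = g'.1 ⟨K, hK.trans (le_iSup U i)⟩ :=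
      (congrArg (fun s : S.Sections (U i) => s.1 ⟨K, hK⟩) (hg' i)).symm
    rw [this]
    exact g'.2.2 ⟨K, hK.trans (le_iSup U i)⟩ Z hKZ

/-- The sheaf associated with a skew lattice over the lattice of compact open sets. -/
def sheaf : TopCat.Sheaf (Type u) (TopCat.of X) := ⟨S.presheaf, S.presheaf_isSheaf⟩

/-- The restrictions of an element, as a section of the associated sheaf. -/
def toSections (x : S.carrier) (U : Opens X) (hU : U ≤ (S.proj x).toOpens) : S.Sections U :=
  -- The chosen element over `K` is immaterial, because a meet depends on its left factor only
  -- through the projection.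
  ⟨fun K => (S.exists_proj_eq K.1).choose ⋏ x, fun K => by
    rw [proj_meet, (S.exists_proj_eq K.1).choose_spec]
    exact inf_eq_left.2 (K.2.trans hU), fun K K' h => by
    have hx : S.proj ((S.exists_proj_eq K'.1).choose ⋏ x) ≤ S.proj x := by
      rw [proj_meet]
      exact inf_le_right
    rw [SkewLattice.meet_assoc, meet_of_proj_le hx, ← SkewLattice.meet_assoc]
    refine meet_congr_of_proj ?_ x
    rw [proj_meet, (S.exists_proj_eq K.1).choose_spec, (S.exists_proj_eq K'.1).choose_spec]
    exact inf_eq_left.2 h⟩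

theorem isGlobalSheaf_sheaf : IsGlobalSheaf X S.sheaf := by
  obtain ⟨x, hx⟩ := S.exists_proj_eq ⊤
  exact ⟨S.toSections x ⊤ (by rw [hx]; exact fun _ _ => trivial)⟩

/-- The element of `S` given by a local section of the associated sheaf. -/
def ofLocalSection (x : LocalSection S.sheaf) : S.carrier :=
  (show S.Sections x.1.toOpens from x.2).1 ⟨x.1, le_rfl⟩

theorem proj_ofLocalSection (x : LocalSection S.sheaf) : S.proj (S.ofLocalSection x) = x.1 :=
  (show S.Sections x.1.toOpens from x.2).2.1 _

/-- A compatible family on a compact open `K` is determined by its member at `K` itself, of which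
all others are restrictions. -/
theorem ofLocalSection_bijective : Function.Bijective S.ofLocalSection := by
  constructor
  · rintro ⟨K, s⟩ ⟨K', t⟩ h
    obtain rfl : K = K' := (S.proj_ofLocalSection ⟨K, s⟩).symm.trans
      ((congrArg S.proj h).trans (S.proj_ofLocalSection ⟨K', t⟩))
    congr 1
    refine Subtype.ext (funext fun V => ?_)
    have hs := s.2.2 V ⟨K, le_rfl⟩ V.2
    have ht := t.2.2 V ⟨K, le_rfl⟩ V.2
    rw [← hs, ← ht]
    refine (meet_congr_of_proj ((s.2.1 V).trans (t.2.1 V).symm) _).trans ?_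
    exact congrArg (t.1 V ⋏ ·) h
  · intro x
    refine ⟨⟨S.proj x, S.toSections x _ le_rfl⟩, ?_⟩
    exact meet_of_proj_le (S.exists_proj_eq _).choose_spec.ge

/-- Local sections of the associated sheaf are elements of `S`. -/
def localSectionEquiv : LocalSection S.sheaf ≃ S.carrier :=
  Equiv.ofBijective _ S.ofLocalSection_bijective

theorem localSectionEquiv_meet (x y : LocalSection S.sheaf) :
    S.localSectionEquiv (x.meet y) = S.localSectionEquiv x ⋏ S.localSectionEquiv y := by
  refine (meet_eq_of_proj_eq (S := S) ?_ ?_).symm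
  · exact (show S.Sections y.1.toOpens from y.2).2.2 ⟨x.1 ⊓ y.1, fun _ h => h.2⟩ ⟨y.1, le_rfl⟩
      inf_le_right
  · exact (S.proj_meet _ _).trans ((congrArg₂ (· ⊓ ·) (S.proj_ofLocalSection x)
      (S.proj_ofLocalSection y)).trans (S.proj_ofLocalSection (x.meet y)).symm)

/-- The skew lattice structure on local sections of the associated sheaf. -/
@[reducible]
def localSectionSkewLattice : SkewLattice (LocalSection S.sheaf) where
  meet := LocalSection.meet
  join x y := S.localSectionEquiv.symm (S.localSectionEquiv x ⋎ S.localSectionEquiv y)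
  meet_assoc x y z := by
    apply S.localSectionEquiv.injective
    simp only [localSectionEquiv_meet, SkewLattice.meet_assoc]
  join_assoc x y z := by simp only [Equiv.apply_symm_apply, SkewLattice.join_assoc]
  meet_idem x := by
    apply S.localSectionEquiv.injective
    rw [localSectionEquiv_meet, SkewLattice.meet_idem]
  join_idem x := by rw [SkewLattice.join_idem, Equiv.symm_apply_apply]
  meet_join_right x y := by
    rw [localSectionEquiv_meet, SkewLattice.meet_join_right, Equiv.symm_apply_apply]
  meet_join_left x y := by
    apply S.localSectionEquiv.injective
    rw [localSectionEquiv_meet, Equiv.apply_symm_apply, SkewLattice.meet_join_left]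
  join_meet_left x y := by
    rw [localSectionEquiv_meet, SkewLattice.join_meet_left, Equiv.symm_apply_apply]
  join_meet_right x y := by
    apply S.localSectionEquiv.injective
    rw [localSectionEquiv_meet, Equiv.apply_symm_apply, SkewLattice.join_meet_right]

/-- The skew lattice structure on local sections of the associated sheaf extends the band
structure. -/
def skewExtension : SkewExtension S.sheaf :=
  ⟨S.localSectionSkewLattice, fun _ _ => rfl,
    LocalSection.isRightDistributive_of_symmetric S.localSectionSkewLattice (fun _ _ => rfl)
      S.isGlobalSheaf_sheaf fun x y => by
        change x.meet y = y.meet x ↔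
          S.localSectionEquiv.symm (S.localSectionEquiv x ⋎ S.localSectionEquiv y) =
            S.localSectionEquiv.symm (S.localSectionEquiv y ⋎ S.localSectionEquiv x)
        rw [S.localSectionEquiv.symm.injective.eq_iff, ← S.isRightDistributive.symmetric,
          ← S.localSectionEquiv.injective.eq_iff, localSectionEquiv_meet, localSectionEquiv_meet]⟩

/-- The global algebra associated with a skew lattice. -/
def globalPatchAlgebra : GlobalPatchAlgebra X :=
  let ξ := (patchAlgebraStructureEquiv S.isGlobalSheaf_sheaf).symm S.skewExtension
  ⟨⟨S.sheaf, ξ.a, ξ.unit, ξ.assoc⟩, S.isGlobalSheaf_sheaf⟩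

theorem str_globalPatchAlgebra_join (x y : LocalSection S.sheaf) :
    (GlobalPatchAlgebra.str S.globalPatchAlgebra).join x y =
      S.localSectionEquiv.symm (S.localSectionEquiv x ⋎ S.localSectionEquiv y) := by
  have := (patchAlgebraStructureEquiv S.isGlobalSheaf_sheaf).apply_symm_apply S.skewExtension
  exact congrArg (fun J : SkewExtension S.sheaf => J.1.join x y) this

/-- A skew lattice is isomorphic to the skew lattice of its associated algebra. -/
def skewLatticeFunctorObjIso : (skewLatticeFunctor X).obj S.globalPatchAlgebra ≅ S where
  hom :=
    { toFun := S.localSectionEquiv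
      map_meet := S.localSectionEquiv_meet
      map_join := fun x y => by
        refine (congrArg S.localSectionEquiv (S.str_globalPatchAlgebra_join x y)).trans ?_
        exact S.localSectionEquiv.apply_symm_apply _
      proj_comp := S.proj_ofLocalSection }
  inv :=
    { toFun := S.localSectionEquiv.symm
      map_meet := fun x y => by
        apply S.localSectionEquiv.injective
        refine Eq.trans ?_ (S.localSectionEquiv_meet _ _).symm
        simp only [Equiv.apply_symm_apply]
      map_join := fun x y => by
        refine Eq.trans ?_ (S.str_globalPatchAlgebra_join _ _).symm
        simp only [Equiv.apply_symm_apply]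
        rfl
      proj_comp := fun x => by
        refine (S.proj_ofLocalSection (S.localSectionEquiv.symm x)).symm.trans ?_
        exact congrArg S.proj (S.localSectionEquiv.apply_symm_apply x) }
  hom_inv_id := Hom.ext (funext S.localSectionEquiv.symm_apply_apply)
  inv_hom_id := Hom.ext (funext S.localSectionEquiv.apply_symm_apply)

end Sheaf

end RightDistributiveSkewLatticeOver

instance {X : Type u} [TopologicalSpace X] [SpectralSpace X] :
    (skewLatticeFunctor X).EssSurj where
  mem_essImage S := ⟨S.globalPatchAlgebra, ⟨S.skewLatticeFunctorObjIso⟩⟩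

instance {X : Type u} [TopologicalSpace X] [SpectralSpace X] :
    (skewLatticeFunctor X).IsEquivalence where

end

theorem mainTheorem2 (X : Type u) [TopologicalSpace X] [SpectralSpace X] :
    (∃ (E : GlobalPatchAlgebra X ≌ RightDistributiveSkewLatticeOver (CompactOpens X))
        (e : ∀ A : GlobalPatchAlgebra X, (E.functor.obj A).carrier ≃ LocalSection A.obj.A),
      (∀ A x, (e A x).1 = (E.functor.obj A).proj x) ∧
      (∀ A x y, e A (x ⋏ y) = (e A x).meet (e A y)) ∧
      (∀ A x y, IsPatchJoin A.obj.a (e A x) (e A y) (e A (x ⋎ y))) ∧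
      (∀ (A B : GlobalPatchAlgebra X) (f : A ⟶ B) x,
        e B ((E.functor.map f).toFun x) = (e A x).map f.hom.f)) ∧
    (∀ F : TopCat.Sheaf (Type u) (TopCat.of X), IsGlobalSheaf X F →
      ∃ c : PatchAlgebraStructure F ≃ SkewExtension F,
        ∀ ξ x y, IsPatchJoin ξ.a x y ((c ξ).1.join x y)) := by
  refine ⟨⟨(skewLatticeFunctor X).asEquivalence, fun A => Equiv.refl _, fun A x => rfl,
    fun A x y => rfl, fun A x y => isPatchJoin_iff.2 rfl, fun A B f x => rfl⟩, fun F hF => ?_⟩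
  exact ⟨patchAlgebraStructureEquiv hF, fun ξ x y => isPatchJoin_iff.2 rfl⟩
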